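/- Let $\alpha=(\alpha_i)_{i\in\mathbb Z}$ be non-negative numbers, at least two of them positive, with $\sum_i\alpha_i=a<\infty$. Let $\pi=(\pi_i)_{i\in\mathbb Z}$ be a random probability vector with the Dirichlet distribution with parameters $\alpha$; that is, $\pi_i=0$ a.s. if $\alpha_i=0$, and for every finite set $F$ of indices with $\alpha_i>0$ for $i\in F$ and $\sum_{i\in F}\alpha_i<a$, the vector $((\pi_i)_{i\in F},\,1-\sum_{i\in F}\pi_i)$ has the usual Dirichlet distribution (given by its density on the simplex) with parameters $((\alpha_i)_{i\in F},\,a-\sum_{i\in F}\alpha_i)$. Let $\Pi(n)=(\pi_{i,j}(n))_{i,j\in\mathbb Z}$, $n\ge 1$, be random row-stochastic matrices such that the vectors $(\pi_{i,i+j}(n))_{j\in\mathbb Z}$, $i\in\mathbb Z$, $n\ge1$, are i.i.d. copies of $\pi$, and for a random sequence $\tau^0=(\tau^0_i)_{i\in\mathbb Z}$ independent of all $\Pi(n)$ put $\tau^{n+1}=\tau^n\Pi(n+1)$, that is, $\tau^{n+1}_j=\sum_i\tau^n_i\,\pi_{i,j}(n+1)$, so that $\tau^n=\tau^0\,\Pi(1)\cdots\Pi(n)$.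 Call $\tau^0$ admissible if its entries are non-negative i.i.d. random variables with finite second moment and mean $\mu=\mathbb E\tau^0_0>0$. Let $\Rightarrow$ denote weak convergence of all finite-dimensional distributions. A random sequence $\tau^\infty=(\tau^\infty_i)_{i\in\mathbb Z}$ of real random variables, independent of the $\Pi(n)$, is called a fixed point if (i) $\tau^\infty\Pi(1)$ is a.s. well defined and has the same distribution as $\tau^\infty$, and (ii) for every admissible $\tau^0$ there is a constant $c>0$ with $\tau^n\Rightarrow c\,\tau^\infty$ as $n\to\infty$. Write $\Gamma(a,\gamma)$ for the Gamma distribution with shape $a$ and rate $\gamma$. Then: 1. A random sequence $\tau^\infty$ is a fixed point if and only if, for some $\gamma>0$, its components are independent and $\Gamma(a,\gamma)$-distributed. 2. For every admissible $\tau^0$, almost surely all the series defining $\tau^n$, $n\ge1$, converge, and $\tau^n\Rightarrow\tau^\infty$ as $n\to\infty$, where the components of $\tau^\infty$ are independent and $\Gamma(a,a/\mu)$-distributed with $\mu=\mathbb E\tau^0_0$. -/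

import Mathlib

open MeasureTheory ProbabilityTheory Filter Topology
open scoped ENNReal BoundedContinuousFunction

namespace RandomExchange

noncomputable section

/-- The Dirichlet density with positive parameters `(α i)` for `i : ι`, together with one more
parameter `b`, on the simplex parametrised by the coordinates `x i`, `i : ι`; the remaining
coordinate, which carries the parameter `b`, is `1 - ∑ i, x i`. The density is taken with respect
to Lebesgue measure in the coordinates `x`. -/
def dirichletDensity {ι : Type*} [Fintype ι] (α : ι → ℝ) (b : ℝ) (x : ι → ℝ) : ℝ≥0∞ :=
  open Classical in
  if (∀ i, 0 < x i) ∧ ∑ i, x i < 1 then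
    ENNReal.ofReal (Real.Gamma ((∑ i, α i) + b) / ((∏ i, Real.Gamma (α i)) * Real.Gamma b)
      * ((∏ i, x i ^ (α i - 1)) * (1 - ∑ i, x i) ^ (b - 1)))
  else 0

/-- `ρ` is the Dirichlet law on probability vectors indexed by `ℤ`, with non-negative summable
parameters `α` (finitely or infinitely many of them positive). Coordinates with parameter `0`
vanish; for every finite set `F` of coordinates with positive parameters which does not exhaust the
total parameter, the vector formed by the coordinates in `F` and the remaining mass
`1 - ∑ i ∈ F, p i` has the Dirichlet distribution with parameters `(α i)`, `i ∈ F`, and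
`∑' i, α i - ∑ i ∈ F, α i`. -/
structure IsDirichlet (α : ℤ → ℝ) (ρ : Measure (ℤ → ℝ)) : Prop where
  isProbabilityMeasure : IsProbabilityMeasure ρ
  nonneg : ∀ᵐ p ∂ρ, ∀ i, 0 ≤ p i
  hasSum_one : ∀ᵐ p ∂ρ, HasSum p 1
  eq_zero : ∀ i, α i = 0 → ∀ᵐ p ∂ρ, p i = 0
  map_restrict : ∀ F : Finset ℤ, (∀ i ∈ F, 0 < α i) → ∑ i ∈ F, α i < ∑' i, α i →
    ρ.map F.restrict = (volume : Measure (F → ℝ)).withDensity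
      (dirichletDensity (fun i : F => α i) (∑' i, α i - ∑ i ∈ F, α i))

/-- One exchange step `τ ↦ τ Π`, where row `i` of the exchange matrix is given relative to its
agent: `p i k` is the proportion which agent `i` gives to agent `i + k`, so the matrix entry
`Π i j` is `p i (j - i)`. -/
def exchangeStep (τ : ℤ → ℝ) (p : ℤ → ℤ → ℝ) : ℤ → ℝ :=
  fun j => ∑' i, τ i * p i (j - i)

/-- The mass configuration `τ Π(1) ⋯ Π(n)` after `n` steps; `p n` describes the exchange matrix
`Π(n + 1)`, that is, the one used in passing from time `n` to time `n + 1`. -/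
def massAt (τ : ℤ → ℝ) (p : ℕ → ℤ → ℤ → ℝ) : ℕ → ℤ → ℝ
  | 0 => τ
  | n + 1 => exchangeStep (massAt τ p n) (p n)

/-- The law of an i.i.d. environment: the proportion vectors for all (time, agent) are independent
copies of the sharing vector with law `ρ`. -/
def environmentLaw (ρ : Measure (ℤ → ℝ)) : Measure (ℕ → ℤ → ℤ → ℝ) :=
  Measure.infinitePi fun _ : ℕ => Measure.infinitePi fun _ : ℤ => ρ

/-- The law of the configuration at time `n`, started from a configuration with law `ν` which is
independent of the environment. -/
def massLaw (ρ ν : Measure (ℤ → ℝ)) (n : ℕ) : Measure (ℤ → ℝ) :=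
  (ν.prod (environmentLaw ρ)).map fun x => massAt x.1 x.2 n

/-- Weak convergence of the laws of infinite random sequences: weak convergence of all
finite-dimensional marginals. -/
def WeaklyConverges (ν : ℕ → Measure (ℤ → ℝ)) (ν' : Measure (ℤ → ℝ)) : Prop :=
  ∀ (I : Finset ℤ) (f : (I → ℝ) →ᵇ ℝ),
    Tendsto (fun n => ∫ x, f (I.restrict x) ∂(ν n)) atTop (𝓝 (∫ x, f (I.restrict x) ∂ν'))

/-- The law of a non-negative initial mass with finite second moment and positive mean. -/
structure IsMassLaw (F : Measure ℝ) : Prop where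
  isProbabilityMeasure : IsProbabilityMeasure F
  nonneg : ∀ᵐ x ∂F, 0 ≤ x
  memLp_two : MemLp (fun x : ℝ => x) 2 F
  mean_pos : 0 < ∫ x, x ∂F

/-- `ν` is the law of a fixed point `τ∞` of the exchange dynamics with sharing law `ρ`:
`τ∞ Π(1)` is almost surely well defined and has the same law as `τ∞`, and from every i.i.d. initial
configuration `τ⁰` of non-negative masses with finite second moment and positive mean, the iterates
`τ⁰ Π(1) ⋯ Π(n)` converge weakly to `τ∞`, up to scaling by a positive constant. -/
structure IsFixedPoint (ρ ν : Measure (ℤ → ℝ)) : Prop where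
  isProbabilityMeasure : IsProbabilityMeasure ν
  summable : ∀ᵐ x ∂(ν.prod (environmentLaw ρ)), ∀ j, Summable fun i => x.1 i * x.2 0 i (j - i)
  invariant : massLaw ρ ν 1 = ν
  attracts : ∀ F : Measure ℝ, IsMassLaw F → ∃ c : ℝ, 0 < c ∧
    WeaklyConverges (massLaw ρ (Measure.infinitePi fun _ : ℤ => F))
      (ν.map fun x i => c * x i)

/-- The random exchange model on a probability space `(Ω, P)`: `τ` is the initial configuration,
with i.i.d. masses of law `F`; `p n i` is the proportion vector (relative to `i`) used by agent `i`
in passing from time `n` to time `n + 1`; these vectors are i.i.d. with law `ρ` over all `n` and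
`i`, and independent of `τ`. -/
structure IsExchangeModel {Ω : Type*} [MeasurableSpace Ω] (P : Measure Ω) (F : Measure ℝ)
    (ρ : Measure (ℤ → ℝ)) (τ : ℤ → Ω → ℝ) (p : ℕ → ℤ → Ω → ℤ → ℝ) : Prop where
  measurable_mass : ∀ i, Measurable (τ i)
  measurable_prop : ∀ n i, Measurable (p n i)
  law_mass : ∀ i, P.map (τ i) = F
  law_prop : ∀ n i, P.map (p n i) = ρ
  indep_mass : iIndepFun τ P
  indep_prop : iIndepFun (fun k : ℕ × ℤ => p k.1 k.2) P
  indep : IndepFun (fun ω i => τ i ω) (fun ω (k : ℕ × ℤ) => p k.1 k.2 ω) P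

/-- The law of a sequence of independent `Γ(a, γ)` variables (shape `a`, rate `γ`). -/
def gammaSequence (a γ : ℝ) : Measure (ℤ → ℝ) :=
  Measure.infinitePi fun _ : ℤ => gammaMeasure a γ

end

end RandomExchange

/-! Invariance rests on the Gamma–Dirichlet identity: if `R` is `Γ(a, γ)` and `p` is an independent
Dirichlet vector with total parameter `a`, then the products `R * p k` are independent and `Γ(α k,
γ)`-distributed. Hence, if the masses are i.i.d. `Γ(a, γ)`, all amounts sent from an agent to
another are independent, and the amounts received by `j` have shapes `α (j - i)`, which add up to
`a`. So an exchange step preserves `gammaSequence a γ` (`stepLaw_gammaSequence`).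

Convergence is proved by coupling. Run an admissible configuration and an independent stationary
Gamma configuration with the same mean through the same environment. The dynamics is linear, so the
difference `D` of the two evolves by the same exchange steps. Its mixed moments `E[D j * D k] = r (k
- j)` satisfy a closed recursion (`HasMixedMoments.step`): `r` is transported like the mass of a
random walk on `ℤ` whose steps have the law of the difference of two independent variables with law
`α / a`, and which makes an additional pause at the origin with probability `κ = 1 / (a + 1)`. The
pause comes from the covariances inside a Dirichlet row. Since the means agree, the initial `r` is a
finite mass at the origin.

Such a walk has an invariant measure of infinite total mass, so the mass at the origin should tend
to zero. This is shown by an energy estimate (`tendsto_pairStep_iterate_zero`): the square norm of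
the density relative to that measure decreases, the loss controls the increments of the density
along multiples of some `d ≠ 0`, and an almost constant density of bounded total mass is small. Thus
`E[D j ^ 2] → 0`, and the two configurations have the same weak limit. The moment bounds also give
absolute convergence of all the series.

Fixed points are then identified by uniqueness of weak limits: starting from Gamma masses, the limit
is both a multiple of the fixed point and a Gamma sequence. -/

namespace RandomExchange

/-! ### Decay of the mass at the origin for a random walk with a pause there. -/

section PairRecursion

/-- The configuration `r` with the mass at the origin reduced by the factor `1 - κ`. -/
noncomputable def moverPart (κ : ℝ) (r : ℤ → ℝ) (z : ℤ) : ℝ := if z = 0 then (1 - κ) * r 0 else r z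

/-- One step of the random walk with step distribution `q` which, when at the origin, stays there
with an additional probability `κ`. -/
noncomputable def pairStep (q : ℤ → ℝ) (κ : ℝ) (r : ℤ → ℝ) (k : ℤ) : ℝ :=
  ∑' z, q z * moverPart κ r (k - z) + if k = 0 then κ * r 0 else 0

/-- The energy of a configuration with respect to the reversible measure of `pairStep`. -/
noncomputable def pairEnergy (κ : ℝ) (r : ℤ → ℝ) : ℝ :=
  ∑' k, moverPart κ r k ^ 2 + κ * (1 - κ) * r 0 ^ 2

lemma summable_mul_comp_sub {q f : ℤ → ℝ} (hq0 : ∀ z, 0 ≤ q z) (hq : Summable q)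
    (hf0 : ∀ z, 0 ≤ f z) (hf : Summable f) :
    Summable fun x : ℤ × ℤ => q x.1 * f (x.2 - x.1) := by
  have h := hq.mul_of_nonneg hf hq0 hf0
  let e : ℤ × ℤ ≃ ℤ × ℤ :=
    { toFun := fun x => (x.1, x.2 - x.1)
      invFun := fun x => (x.1, x.2 + x.1)
      left_inv := fun x => by simp
      right_inv := fun x => by simp }
  exact (e.summable_iff (f := fun x : ℤ × ℤ => q x.1 * f x.2)).2 h

lemma hasSum_convolution {q f : ℤ → ℝ} {s t : ℝ} (hq0 : ∀ z, 0 ≤ q z) (hq : HasSum q t)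
    (hf0 : ∀ z, 0 ≤ f z) (hf : HasSum f s) :
    HasSum (fun k => ∑' z, q z * f (k - z)) (t * s) := by
  have h := summable_mul_comp_sub hq0 hq.summable hf0 hf.summable
  have h2 : HasSum (fun x : ℤ × ℤ => q x.1 * f (x.2 - x.1)) (t * s) := by
    have : ∑' x : ℤ × ℤ, q x.1 * f (x.2 - x.1) = t * s := by
      rw [h.tsum_prod]
      have : ∀ z, ∑' k, q z * f (k - z) = q z * s := by
        intro z
        rw [tsum_mul_left, ← hf.tsum_eq]
        congr 1
        exact (Equiv.subRight z).tsum_eq f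
      simp_rw [this]
      rw [tsum_mul_right, hq.tsum_eq]
    rw [← this]
    exact h.hasSum
  have h3 := (Equiv.prodComm ℤ ℤ).hasSum_iff.2 h2
  refine h3.prod_fiberwise fun k => ?_
  exact (((Equiv.prodComm ℤ ℤ).summable_iff.2 h).prod_factor k).hasSum

lemma summable_convolution {q f : ℤ → ℝ} (hq0 : ∀ z, 0 ≤ q z) (hq : Summable q)
    (hf0 : ∀ z, 0 ≤ f z) (hf : Summable f) (k : ℤ) : Summable fun z => q z * f (k - z) :=
  ((Equiv.prodComm ℤ ℤ).summable_iff.2 (summable_mul_comp_sub hq0 hq hf0 hf)).prod_factor k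

/-- The variance of `x` under the weights `w` is at least the contribution of the two atoms `a` and
`b`. By Cauchy–Schwarz and `w a + w b ≤ 1`, this contribution is at least `w a * w b * (x a - x b) ^
2`, whatever the mean is. -/
lemma sq_tsum_add_le {ι : Type*} {w x : ι → ℝ} (hw0 : ∀ i, 0 ≤ w i) (hw : HasSum w 1)
    (h1 : Summable fun i => w i * x i) (h2 : Summable fun i => w i * x i ^ 2) {a b : ι}
    (hab : a ≠ b) :
    (∑' i, w i * x i) ^ 2 + w a * w b * (x a - x b) ^ 2 ≤ ∑' i, w i * x i ^ 2 := by
  classical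
  set m := ∑' i, w i * x i with hm
  have h3 : HasSum (fun i => w i * (x i - m) ^ 2) (∑' i, w i * x i ^ 2 - m ^ 2) := by
    have := (h2.hasSum.sub (h1.hasSum.mul_left (2 * m))).add (hw.mul_left (m ^ 2))
    rw [← hm] at this
    convert! this using 1
    · ext i; ring
    · ring
  have h4 := sum_le_hasSum {a, b} (fun i _ => mul_nonneg (hw0 i) (sq_nonneg (x i - m))) h3
  rw [Finset.sum_pair hab] at h4
  have h5 := sum_le_hasSum {a, b} (fun i _ => hw0 i) hw
  rw [Finset.sum_pair hab] at h5
  have h6 : w a * w b * (x a - x b) ^ 2 ≤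
      (w a + w b) * (w a * (x a - m) ^ 2 + w b * (x b - m) ^ 2) := by
    nlinarith [sq_nonneg (w a * (x a - m) + w b * (x b - m))]
  have h7 : 0 ≤ w a * (x a - m) ^ 2 + w b * (x b - m) ^ 2 :=
    add_nonneg (mul_nonneg (hw0 a) (sq_nonneg _)) (mul_nonneg (hw0 b) (sq_nonneg _))
  nlinarith

lemma summable_sq_of_nonneg {ι : Type*} {f : ι → ℝ} (hf0 : ∀ i, 0 ≤ f i) (hf : Summable f) :
    Summable fun i => f i ^ 2 := by
  refine Summable.of_nonneg_of_le (fun i => sq_nonneg _) (fun i => ?_) (hf.mul_left (∑' i, f i))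
  rw [sq]
  exact mul_le_mul_of_nonneg_right (hf.le_tsum i fun j _ => hf0 j) (hf0 i)

variable {q : ℤ → ℝ} {κ : ℝ} {r : ℤ → ℝ} {s : ℝ}

lemma moverPart_nonneg (hκ1 : κ < 1) (hr : ∀ k, 0 ≤ r k) (k : ℤ) : 0 ≤ moverPart κ r k := by
  unfold moverPart
  split_ifs
  · exact mul_nonneg (by linarith) (hr 0)
  · exact hr k

lemma hasSum_moverPart (hr : HasSum r s) : HasSum (moverPart κ r) (s - κ * r 0) := by
  have := hr.sub (hasSum_ite_eq (0 : ℤ) (κ * r 0))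
  convert! this using 1
  ext k
  unfold moverPart
  split_ifs with h
  · subst h; ring
  · ring

lemma pairStep_nonneg (hq0 : ∀ z, 0 ≤ q z) (hκ0 : 0 ≤ κ) (hκ1 : κ < 1) (hr : ∀ k, 0 ≤ r k)
    (k : ℤ) : 0 ≤ pairStep q κ r k := by
  unfold pairStep
  refine add_nonneg (tsum_nonneg fun z => mul_nonneg (hq0 z) (moverPart_nonneg hκ1 hr _)) ?_
  split_ifs
  · exact mul_nonneg hκ0 (hr 0)
  · exact le_rfl

lemma hasSum_pairStep (hq0 : ∀ z, 0 ≤ q z) (hq : HasSum q 1) (hκ1 : κ < 1)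
    (hr0 : ∀ k, 0 ≤ r k) (hr : HasSum r s) : HasSum (pairStep q κ r) s := by
  have h := (hasSum_convolution hq0 hq (moverPart_nonneg hκ1 hr0) (hasSum_moverPart (κ := κ) hr)).add
    (hasSum_ite_eq (0 : ℤ) (κ * r 0))
  convert! h using 1
  ring

lemma pairEnergy_nonneg (hκ0 : 0 ≤ κ) (hκ1 : κ < 1) : 0 ≤ pairEnergy κ r :=
  add_nonneg (tsum_nonneg fun _ => sq_nonneg _)
    (mul_nonneg (mul_nonneg hκ0 (by linarith)) (sq_nonneg _))

lemma summable_sub_comp_sub_sq {f : ℤ → ℝ} (hf0 : ∀ k, 0 ≤ f k) (hf : Summable f) (d : ℤ) :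
    Summable fun k => (f k - f (k - d)) ^ 2 := by
  have hf2 := summable_sq_of_nonneg hf0 hf
  have h2 : Summable fun k => f (k - d) ^ 2 := hf2.comp_injective (Equiv.subRight d).injective
  refine Summable.of_nonneg_of_le (fun k => sq_nonneg _) (fun k => ?_) (hf2.add h2)
  have := mul_nonneg (hf0 k) (hf0 (k - d))
  rw [sub_sq]
  linarith

/-- The variance bound is applied at each `k` to the weights `q` and the atoms `0` and `d`, and
summed over `k`; averaging with `q` preserves the total of the squares `f k ^ 2`. -/
lemma tsum_convolution_sq_add_le {f : ℤ → ℝ} (hq0 : ∀ z, 0 ≤ q z) (hq : HasSum q 1)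
    (hf0 : ∀ k, 0 ≤ f k) (hf : Summable f) {d : ℤ} (hd : d ≠ 0) :
    ∑' k, (∑' z, q z * f (k - z)) ^ 2 + q 0 * q d * ∑' k, (f k - f (k - d)) ^ 2
      ≤ ∑' k, f k ^ 2 := by
  have hf2 : Summable fun k => f k ^ 2 := summable_sq_of_nonneg hf0 hf
  have hf20 : ∀ k, 0 ≤ f k ^ 2 := fun k => sq_nonneg (f k)
  have hg2 : Summable fun k => (∑' z, q z * f (k - z)) ^ 2 :=
    summable_sq_of_nonneg (fun k => tsum_nonneg fun z => mul_nonneg (hq0 z) (hf0 _))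
      (hasSum_convolution hq0 hq hf0 hf.hasSum).summable
  have hconv (F : ℤ → ℝ) (h0 : ∀ k, 0 ≤ F k) (hF : Summable F) :
      HasSum (fun k => ∑' z, q z * F (k - z)) (∑' k, F k) := by
    simpa only [one_mul] using hasSum_convolution hq0 hq h0 hF.hasSum
  have hc := hconv _ hf20 hf2
  have hdiff := summable_sub_comp_sub_sq hf0 hf d
  have key : ∀ k, (∑' z, q z * f (k - z)) ^ 2 + q 0 * q d * (f k - f (k - d)) ^ 2
      ≤ ∑' z, q z * f (k - z) ^ 2 := by
    intro k
    have := sq_tsum_add_le hq0 hq (x := fun z => f (k - z))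
      (summable_convolution hq0 hq.summable hf0 hf k)
      (summable_convolution hq0 hq.summable hf20 hf2 k) hd.symm
    rwa [sub_zero] at this
  have h := Summable.tsum_le_tsum key (hg2.add (hdiff.mul_left _)) hc.summable
  rwa [hg2.tsum_add (hdiff.mul_left _), tsum_mul_left, hc.tsum_eq] at h

/-- The new mover part differs from the convolution only at the origin: with `G = pairStep q κ r 0`,
it is `(1 - κ) * G` there, whereas the convolution equals `G - κ * r 0`. -/
lemma tsum_moverPart_pairStep_sq (hq0 : ∀ z, 0 ≤ q z) (hq : HasSum q 1) (hκ1 : κ < 1)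
    (hr0 : ∀ k, 0 ≤ r k) (hr : Summable r) :
    ∑' k, moverPart κ (pairStep q κ r) k ^ 2 =
      ∑' k, (∑' z, q z * moverPart κ r (k - z)) ^ 2 +
        ((1 - κ) ^ 2 * pairStep q κ r 0 ^ 2 - (pairStep q κ r 0 - κ * r 0) ^ 2) := by
  have hg2 : Summable fun k => (∑' z, q z * moverPart κ r (k - z)) ^ 2 :=
    summable_sq_of_nonneg
      (fun k => tsum_nonneg fun z => mul_nonneg (hq0 z) (moverPart_nonneg hκ1 hr0 _))
      (hasSum_convolution hq0 hq (moverPart_nonneg hκ1 hr0)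
        (hasSum_moverPart hr.hasSum)).summable
  have := hg2.hasSum.add (hasSum_ite_eq (0 : ℤ)
    ((1 - κ) ^ 2 * pairStep q κ r 0 ^ 2 - (pairStep q κ r 0 - κ * r 0) ^ 2))
  rw [← this.tsum_eq]
  congr 1
  ext k
  by_cases hk : k = 0
  · subst hk
    simp only [moverPart, pairStep, if_true]
    ring
  · simp only [moverPart, pairStep, if_neg hk, add_zero]

/-- The invariant measure has weight `1 / (1 - κ)` at the origin and `1` elsewhere. `moverPart κ r`
is the density of `r` with respect to it, and `pairEnergy` is the square norm of this density. The
terms at the origin combine to `κ * (1 - κ) * r 0 ^ 2` minus a square, so the loss in the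
convolution is not compensated. -/
lemma pairEnergy_pairStep_add_le (hq0 : ∀ z, 0 ≤ q z) (hq : HasSum q 1) (hκ0 : 0 ≤ κ)
    (hκ1 : κ < 1) (hr0 : ∀ k, 0 ≤ r k) (hr : Summable r) {d : ℤ} (hd : d ≠ 0) :
    pairEnergy κ (pairStep q κ r) +
      q 0 * q d * ∑' k, (moverPart κ r k - moverPart κ r (k - d)) ^ 2 ≤ pairEnergy κ r := by
  have h := tsum_convolution_sq_add_le hq0 hq (moverPart_nonneg hκ1 hr0)
    (hasSum_moverPart hr.hasSum).summable (f := moverPart κ r) hd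
  unfold pairEnergy
  rw [tsum_moverPart_pairStep_sq hq0 hq hκ1 hr0 hr]
  generalize pairStep q κ r 0 = G
  have h1 : 0 ≤ κ * (G - r 0) ^ 2 := mul_nonneg hκ0 (sq_nonneg _)
  have h2 : (1 - κ) ^ 2 * G ^ 2 - (G - κ * r 0) ^ 2 + κ * (1 - κ) * G ^ 2
      = κ * (1 - κ) * r 0 ^ 2 - κ * (G - r 0) ^ 2 := by ring
  linarith

/-- A random walk on `ℤ` which is lazier at the origin leaves the origin in the long run. -/
theorem tendsto_pairStep_iterate_zero (hq0 : ∀ z, 0 ≤ q z) (hq : HasSum q 1) (hκ0 : 0 ≤ κ)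
    (hκ1 : κ < 1) (hz : 0 < q 0) {d : ℤ} (hd : d ≠ 0) (hqd : 0 < q d) (hr0 : ∀ k, 0 ≤ r k)
    (hr : Summable r) : Tendsto (fun n => (pairStep q κ)^[n] r 0) atTop (𝓝 0) := by
  set R : ℕ → ℤ → ℝ := fun n => (pairStep q κ)^[n] r with hR
  have hRs : ∀ n, R (n + 1) = pairStep q κ (R n) := fun n => Function.iterate_succ_apply' _ _ _
  have hR0 : ∀ n k, 0 ≤ R n k := by
    intro n
    induction n with
    | zero => exact hr0
    | succ n ih => rw [hRs]; exact pairStep_nonneg hq0 hκ0 hκ1 ih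
  have hRsum : ∀ n, HasSum (R n) (∑' k, r k) := by
    intro n
    induction n with
    | zero => exact hr.hasSum
    | succ n ih => rw [hRs]; exact hasSum_pairStep hq0 hq hκ1 (hR0 n) ih
  set S := ∑' k, r k
  set A : ℕ → ℝ := fun n => ∑' k, (moverPart κ (R n) k - moverPart κ (R n) (k - d)) ^ 2 with hA
  have hE : ∀ n, pairEnergy κ (R (n + 1)) + q 0 * q d * A n ≤ pairEnergy κ (R n) := fun n => by
    rw [hRs]
    exact pairEnergy_pairStep_add_le hq0 hq hκ0 hκ1 (hR0 n) (hRsum n).summable hd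
  have hA0 : ∀ n, 0 ≤ A n := fun n => tsum_nonneg fun _ => sq_nonneg _
  have hc : 0 < q 0 * q d := mul_pos hz hqd
  have hanti : Antitone fun n => pairEnergy κ (R n) := antitone_nat_of_succ_le fun n => by
    nlinarith [hE n, mul_nonneg hc.le (hA0 n)]
  have hlim := tendsto_atTop_ciInf hanti ⟨0, by rintro _ ⟨n, rfl⟩; exact pairEnergy_nonneg hκ0 hκ1⟩
  -- The energies decrease to a limit, so their decrements, which dominate `q 0 * q d * A n`, tend
  -- to zero.
  have hAlim : Tendsto A atTop (𝓝 0) := by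
    have h1 := (hlim.sub (hlim.comp (tendsto_add_atTop_nat 1))).div_const (q 0 * q d)
    simp only [sub_self, zero_div] at h1
    refine squeeze_zero hA0 (fun n => ?_) h1
    rw [le_div_iff₀ hc]
    simp only [Function.comp]
    linarith [hE n]
  have hsqrt : Tendsto (fun n => √(A n)) atTop (𝓝 0) := by
    simpa using hAlim.sqrt
  have hstep : ∀ n k, |moverPart κ (R n) k - moverPart κ (R n) (k - d)| ≤ √(A n) := fun n k => by
    refine Real.abs_le_sqrt ?_
    exact (summable_sub_comp_sub_sq (moverPart_nonneg hκ1 (hR0 n))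
      (hasSum_moverPart (hRsum n)).summable d).le_tsum k fun _ _ => sq_nonneg _
  have hchain : ∀ n (j : ℕ), moverPart κ (R n) 0 ≤ moverPart κ (R n) (-(j * d)) + j * √(A n) := by
    intro n j
    induction j with
    | zero => simp
    | succ j ih =>
      have h := (abs_le.1 (hstep n (-(j * d)))).2
      have e : -(((j + 1 : ℕ) : ℤ) * d) = -(j * d) - d := by push_cast; ring
      rw [e]
      push_cast
      linarith
  -- Comparing the density at the origin with its values at the `N + 1` sites `0, -d, …, -N * d`,
  -- whose sum is at most the total mass `S`.
  have hbound : ∀ n (N : ℕ),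
      (N + 1) * moverPart κ (R n) 0 ≤ S + (N + 1) * ((N + 1) * √(A n)) := by
    intro n N
    have h1 : ∑ j ∈ Finset.range (N + 1), moverPart κ (R n) 0 ≤
        ∑ j ∈ Finset.range (N + 1), (moverPart κ (R n) (-(j * d)) + (N + 1) * √(A n)) := by
      refine Finset.sum_le_sum fun j hj => (hchain n j).trans ?_
      have : (j : ℝ) ≤ N + 1 := by
        have := Finset.mem_range.1 hj
        exact_mod_cast this.le
      nlinarith [Real.sqrt_nonneg (A n)]
    rw [Finset.sum_add_distrib] at h1
    simp only [Finset.sum_const, Finset.card_range, nsmul_eq_mul] at h1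
    have h2 : ∑ j ∈ Finset.range (N + 1), moverPart κ (R n) (-(j * d)) ≤ S := by
      have hinj : Function.Injective fun j : ℕ => -((j : ℤ) * d) := by
        intro i j hij
        simpa [hd] using hij
      have h3 := sum_le_hasSum ((Finset.range (N + 1)).map ⟨_, hinj⟩)
        (fun k _ => moverPart_nonneg hκ1 (hR0 n) k) (hasSum_moverPart (hRsum n))
      rw [Finset.sum_map] at h3
      refine h3.trans ?_
      have := mul_nonneg hκ0 (hR0 n 0)
      linarith
    push_cast at h1
    linarith
  have hS : 0 ≤ S := tsum_nonneg hr0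
  have hmain : Tendsto (fun n => moverPart κ (R n) 0) atTop (𝓝 0) := by
    rw [Metric.tendsto_atTop]
    intro ε hε
    -- With this `N` the mass term `S` is below `(N + 1) * ε / 2`; afterwards `n` is taken so large
    -- that the increment term is below the same bound.
    obtain ⟨N, hN⟩ := exists_nat_gt (2 * S / ε)
    have hN1 : (0 : ℝ) < N + 1 := by positivity
    obtain ⟨n₀, hn₀⟩ := Metric.tendsto_atTop.1 hsqrt (ε / (2 * (N + 1))) (by positivity)
    refine ⟨n₀, fun n hn => ?_⟩
    have h1 := hn₀ n hn
    rw [Real.dist_eq, sub_zero, abs_of_nonneg (Real.sqrt_nonneg _), lt_div_iff₀ (by positivity)]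
      at h1
    have h2 := hbound n N
    rw [div_lt_iff₀ hε] at hN
    rw [Real.dist_eq, sub_zero, abs_of_nonneg (moverPart_nonneg hκ1 (hR0 n) 0)]
    have h3 : (N + 1) * moverPart κ (R n) 0 < (N + 1) * ε := by nlinarith
    exact lt_of_mul_lt_mul_left h3 hN1.le
  have h := hmain.div_const (1 - κ)
  rw [zero_div] at h
  refine h.congr fun n => ?_
  have : 1 - κ ≠ 0 := by linarith
  simp only [moverPart, if_true, hR]
  field_simp

end PairRecursion

/-! ### Densities of finite product measures. -/

section ProductDensity

lemma lintegral_fin_prod_eq_prod {n : ℕ} {E : Type*} [MeasurableSpace E]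
    {μ : Fin n → Measure E} [∀ i, SigmaFinite (μ i)]
    {f : Fin n → E → ℝ≥0∞} (hf : ∀ i, Measurable (f i)) :
    ∫⁻ x, ∏ i, f i (x i) ∂(Measure.pi μ) = ∏ i, ∫⁻ x, f i x ∂(μ i) := by
  induction n with
  | zero => simp
  | succ n ih =>
    rw [← ((measurePreserving_piFinSuccAbove μ 0).symm).lintegral_comp_emb
      (MeasurableEquiv.measurableEmbedding _), Fin.prod_univ_succ,
      ← ih (μ := fun j => μ j.succ) (f := fun j => f j.succ) (fun i => hf _),
      ← lintegral_prod_mul (g := fun x : Fin n → E => ∏ i, f i.succ (x i)) (hf 0).aemeasurable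
        (Finset.measurable_fun_prod _ fun i _ =>
          (hf i.succ).comp (measurable_pi_apply i)).aemeasurable]
    refine lintegral_congr fun z => ?_
    rw [Fin.prod_univ_succ]
    rfl

lemma lintegral_fintype_prod_eq_prod {ι : Type*} [Fintype ι] {E : Type*} [MeasurableSpace E]
    {μ : ι → Measure E} [∀ i, SigmaFinite (μ i)]
    {f : ι → E → ℝ≥0∞} (hf : ∀ i, Measurable (f i)) :
    ∫⁻ x, ∏ i, f i (x i) ∂(Measure.pi μ) = ∏ i, ∫⁻ x, f i x ∂(μ i) := by
  let e := (Fintype.equivFin ι).symm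
  rw [← (measurePreserving_piCongrLeft _ e).lintegral_comp_emb
    (MeasurableEquiv.measurableEmbedding _)]
  simp_rw [← e.prod_comp, MeasurableEquiv.coe_piCongrLeft, Equiv.piCongrLeft_apply_apply]
  exact lintegral_fin_prod_eq_prod fun i => hf _

lemma pi_withDensity {ι : Type*} [Fintype ι] {E : Type*} [MeasurableSpace E]
    {μ : ι → Measure E} [∀ i, SigmaFinite (μ i)]
    {f : ι → E → ℝ≥0∞} (hf : ∀ i, Measurable (f i))
    [∀ i, SigmaFinite ((μ i).withDensity (f i))] :
    Measure.pi (fun i => (μ i).withDensity (f i)) =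
      (Measure.pi μ).withDensity fun x => ∏ i, f i (x i) := by
  refine Measure.pi_eq fun s hs => ?_
  rw [withDensity_apply _ (MeasurableSet.univ_pi hs), Measure.restrict_pi_pi,
    lintegral_fintype_prod_eq_prod hf]
  exact Finset.prod_congr rfl fun i _ => (withDensity_apply _ (hs i)).symm

end ProductDensity

/-! ### The Gamma–Dirichlet identity. -/

section GammaDirichlet

variable {ι : Type*} [Fintype ι]

lemma lintegral_comp_smul_pi (G : (ι → ℝ) → ℝ≥0∞) {r : ℝ} (hr : 0 < r) :
    ∫⁻ x, G (r • x) = ENNReal.ofReal ((r ^ Fintype.card ι)⁻¹) * ∫⁻ y, G y := by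
  have h := Measure.map_addHaar_smul (volume : Measure (ι → ℝ)) hr.ne'
  have e : MeasurableEmbedding (fun x : ι → ℝ => r • x) :=
    (Homeomorph.smulOfNeZero r hr.ne').measurableEmbedding
  rw [← e.lintegral_map, h, lintegral_smul_measure, Module.finrank_fintype_fun_eq_card,
    abs_of_pos (by positivity), smul_eq_mul]

lemma measurable_dirichletDensity (β : ι → ℝ) (b : ℝ) : Measurable (dirichletDensity β b) := by
  unfold dirichletDensity
  refine Measurable.ite ?_ ?_ measurable_const
  · refine MeasurableSet.inter ?_ ?_
    · have : {x : ι → ℝ | ∀ i, 0 < x i} = ⋂ i, {x : ι → ℝ | 0 < x i} := by ext; simp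
      change MeasurableSet {x : ι → ℝ | ∀ i, 0 < x i}
      rw [this]
      exact MeasurableSet.iInter fun i => measurableSet_lt measurable_const (measurable_pi_apply i)
    · exact measurableSet_lt (f := fun x : ι → ℝ => ∑ i, x i) (by fun_prop) measurable_const
  · fun_prop

lemma measurable_gammaPDF (a γ : ℝ) : Measurable (gammaPDF a γ) :=
  (measurable_gammaPDFReal a γ).ennreal_ofReal

/-- The densities agree pointwise under the change of variables `y = r • x`, `s = r - ∑ i, y i`,
whose Jacobian gives the factor `r ^ (-card ι)`. All powers of `r` cancel, and `exp (-γ r)` splits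
over the coordinates. -/
lemma gammaPDF_mul_dirichletDensity {β : ι → ℝ} {b γ : ℝ} (hβ : ∀ i, 0 < β i) (hb : 0 < b)
    (hγ : 0 < γ) {y : ι → ℝ} {s : ℝ} (hy : ∀ i, 0 < y i) (hs : 0 < s) :
    gammaPDF (∑ i, β i + b) γ (s + ∑ i, y i) *
      (ENNReal.ofReal (((s + ∑ i, y i) ^ Fintype.card ι)⁻¹) *
        dirichletDensity β b ((s + ∑ i, y i)⁻¹ • y)) =
      (∏ i, gammaPDF (β i) γ (y i)) * gammaPDF b γ s := by
  have hY : 0 ≤ ∑ i, y i := Finset.sum_nonneg fun i _ => (hy i).le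
  set r := s + ∑ i, y i with hr
  have hr0 : 0 < r := by linarith
  have hB : 0 ≤ ∑ i, β i := Finset.sum_nonneg fun i _ => (hβ i).le
  have hsum : ∑ i, (r⁻¹ • y) i = r⁻¹ * ∑ i, y i := by
    simp [Finset.mul_sum]
  have h1 : 1 - r⁻¹ * ∑ i, y i = r⁻¹ * s := by
    field_simp
    linarith
  have hG : ∀ i, 0 < Real.Gamma (β i) := fun i => Real.Gamma_pos_of_pos (hβ i)
  have hcond : (∀ i, 0 < (r⁻¹ • y) i) ∧ ∑ i, (r⁻¹ • y) i < 1 := by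
    refine ⟨fun i => mul_pos (inv_pos.2 hr0) (hy i), ?_⟩
    rw [hsum]
    have : 0 < r⁻¹ * s := by positivity
    linarith
  rw [dirichletDensity, if_pos hcond, hsum, h1, gammaPDF_of_nonneg hr0.le,
    gammaPDF_of_nonneg hs.le]
  simp_rw [fun i => gammaPDF_of_nonneg (a := β i) (r := γ) (hy i).le]
  rw [← ENNReal.ofReal_mul (by positivity),
    ← ENNReal.ofReal_mul (by have := Real.Gamma_pos_of_pos (by linarith : 0 < ∑ i, β i + b)
                             positivity),
    ← ENNReal.ofReal_prod_of_nonneg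
      (fun i _ => by have := hG i; have := hy i; positivity),
    ← ENNReal.ofReal_mul (Finset.prod_nonneg fun i _ => by
      have := hG i; have := hy i; positivity)]
  congr 1
  have hpow : ∏ i, (r⁻¹ • y) i ^ (β i - 1) =
      (r⁻¹) ^ (∑ i, β i - Fintype.card ι) * ∏ i, y i ^ (β i - 1) := by
    have : ∀ i, (r⁻¹ • y) i ^ (β i - 1) = (r⁻¹) ^ (β i - 1) * y i ^ (β i - 1) := fun i =>
      Real.mul_rpow (inv_pos.2 hr0).le (hy i).le
    simp_rw [this]
    rw [Finset.prod_mul_distrib, ← Real.rpow_sum_of_pos (inv_pos.2 hr0)]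
    congr 2
    simp
  have hexp : ∏ i, Real.exp (-(γ * y i)) = Real.exp (-(γ * ∑ i, y i)) := by
    rw [← Real.exp_sum, Finset.sum_neg_distrib, Finset.mul_sum]
  have hprod : ∏ i, γ ^ β i / Real.Gamma (β i) * y i ^ (β i - 1) * Real.exp (-(γ * y i)) =
      γ ^ (∑ i, β i) / (∏ i, Real.Gamma (β i)) * (∏ i, y i ^ (β i - 1)) *
        Real.exp (-(γ * ∑ i, y i)) := by
    rw [Finset.prod_mul_distrib, Finset.prod_mul_distrib, Finset.prod_div_distrib, hexp,
      ← Real.rpow_sum_of_pos hγ]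
  have hrpow : r ^ (∑ i, β i + b - 1) * (r ^ Fintype.card ι)⁻¹ *
      (r⁻¹) ^ (∑ i, β i - Fintype.card ι) * (r⁻¹) ^ (b - 1) = 1 := by
    rw [Real.inv_rpow hr0.le, Real.inv_rpow hr0.le, ← Real.rpow_natCast, ← Real.rpow_neg hr0.le,
      ← Real.rpow_neg hr0.le, ← Real.rpow_neg hr0.le, ← Real.rpow_add hr0, ← Real.rpow_add hr0,
      ← Real.rpow_add hr0]
    convert Real.rpow_zero r using 2
    ring
  have hexp2 : Real.exp (-(γ * r)) = Real.exp (-(γ * ∑ i, y i)) * Real.exp (-(γ * s)) := by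
    rw [← Real.exp_add]
    congr 1
    rw [hr]
    ring
  have hGa := (Real.Gamma_pos_of_pos (by linarith : 0 < ∑ i, β i + b)).ne'
  have hGb := (Real.Gamma_pos_of_pos hb).ne'
  have hGp : ∏ i, Real.Gamma (β i) ≠ 0 := Finset.prod_ne_zero_iff.2 fun i _ => (hG i).ne'
  rw [hprod, hpow, hexp2, Real.mul_rpow (inv_pos.2 hr0).le hs.le, Real.rpow_add hγ]
  generalize Real.Gamma (∑ i, β i + b) = A at *
  generalize Real.Gamma b = B at *
  generalize ∏ i, Real.Gamma (β i) = C at *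
  generalize Real.exp (-(γ * ∑ i, y i)) = E1
  generalize Real.exp (-(γ * s)) = E2
  generalize ∏ i, y i ^ (β i - 1) = Y
  generalize r ^ (∑ i, β i + b - 1) = R1 at *
  generalize (r ^ Fintype.card ι)⁻¹ = R2 at *
  generalize (r⁻¹) ^ (∑ i, β i - Fintype.card ι) = R3 at *
  generalize (r⁻¹) ^ (b - 1) = R4 at *
  have : γ ^ (∑ i, β i) * γ ^ b / A * R1 * (E1 * E2) *
      (R2 * (A / (C * B) * (R3 * Y * (R4 * s ^ (b - 1))))) =
      (A / A) * (γ ^ (∑ i, β i) / C * Y * E1 * (γ ^ b / B * s ^ (b - 1) * E2)) *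
        (R1 * R2 * R3 * R4) := by
    ring
  rw [this, hrpow, div_self hGa, one_mul, mul_one]

/-- If `R` has a Gamma distribution and `X` an independent Dirichlet distribution with the same
total parameter, then the components of `R X` are independent and Gamma distributed. -/
theorem lintegral_gamma_mul_dirichlet {β : ι → ℝ} {b γ : ℝ} (hβ : ∀ i, 0 < β i) (hb : 0 < b)
    (hγ : 0 < γ) {Φ : (ι → ℝ) × ℝ → ℝ≥0∞} (hΦ : Measurable Φ) :
    ∫⁻ r, ∫⁻ x, Φ (r • x, r - ∑ i, r * x i)
        ∂(volume.withDensity (dirichletDensity β b)) ∂(gammaMeasure (∑ i, β i + b) γ) =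
      ∫⁻ y, Φ y ∂((Measure.pi fun i => gammaMeasure (β i) γ).prod (gammaMeasure b γ)) := by
  have : ∀ i, IsProbabilityMeasure (gammaMeasure (β i) γ) := fun i =>
    isProbabilityMeasure_gammaMeasure (hβ i) hγ
  have := isProbabilityMeasure_gammaMeasure hb hγ
  have hD := measurable_dirichletDensity β b
  set a := ∑ i, β i + b with ha
  -- The joint density of `(r • x, r)`, set to zero for `r ≤ 0`, where the rescaling by `r⁻¹` has no
  -- meaning for the model.
  let H : (ι → ℝ) → ℝ → ℝ≥0∞ := fun y r =>
    if 0 < r then gammaPDF a γ r * (ENNReal.ofReal ((r ^ Fintype.card ι)⁻¹) *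
      dirichletDensity β b (r⁻¹ • y)) else 0
  have hH : Measurable (Function.uncurry H) := by
    refine Measurable.ite (measurableSet_lt measurable_const measurable_snd) ?_ measurable_const
    exact ((measurable_gammaPDF a γ).comp measurable_snd).mul
      (Measurable.mul (by fun_prop) (hD.comp (by fun_prop)))
  have hH' : ∀ y, Measurable (H y) := fun y => hH.comp measurable_prodMk_left
  have step1 : ∫⁻ r, ∫⁻ x, Φ (r • x, r - ∑ i, r * x i)
        ∂(volume.withDensity (dirichletDensity β b)) ∂(gammaMeasure a γ) =
      ∫⁻ r, ∫⁻ y, H y r * Φ (y, r - ∑ i, y i) := by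
    rw [gammaMeasure, lintegral_withDensity_eq_lintegral_mul _ (measurable_gammaPDF a γ)]
    · have h0 : ∀ᵐ r : ℝ, r ≠ 0 := by simp [ae_iff]
      refine lintegral_congr_ae (h0.mono fun r hr => ?_)
      rcases lt_or_gt_of_ne hr with hr | hr
      · simp [H, gammaPDF_of_neg hr, not_lt.2 hr.le]
      · have hmeas : Measurable fun x : ι → ℝ => Φ (r • x, r - ∑ i, r * x i) := by fun_prop
        simp only [Pi.mul_apply, H, if_pos hr]
        rw [lintegral_withDensity_eq_lintegral_mul _ hD hmeas]
        have h1 := lintegral_comp_smul_pi (ι := ι)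
          (fun y => dirichletDensity β b (r⁻¹ • y) * Φ (y, r - ∑ i, y i)) hr
        simp only [smul_smul, inv_mul_cancel₀ hr.ne', one_smul, Pi.smul_apply, smul_eq_mul] at h1
        simp only [Pi.mul_apply]
        rw [h1, ← lintegral_const_mul _ (by fun_prop), ← lintegral_const_mul _ (by fun_prop)]
        simp only [mul_assoc]
    · refine Measurable.lintegral_prod_right' (f := fun z : ℝ × (ι → ℝ) =>
        Φ (z.1 • z.2, z.1 - ∑ i, z.1 * z.2 i)) (by fun_prop)
  have hswap : ∫⁻ r, ∫⁻ y, H y r * Φ (y, r - ∑ i, y i) =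
      ∫⁻ y, ∫⁻ r, H y r * Φ (y, r - ∑ i, y i) := by
    rw [lintegral_lintegral_swap]
    have h2 : Measurable fun z : ℝ × (ι → ℝ) => H z.2 z.1 := hH.comp measurable_swap
    exact (h2.mul (by fun_prop)).aemeasurable
  have hprod : (Measure.pi fun i => gammaMeasure (β i) γ).prod (gammaMeasure b γ) =
      (volume.prod volume).withDensity
        (fun z : (ι → ℝ) × ℝ => (∏ i, gammaPDF (β i) γ (z.1 i)) * gammaPDF b γ z.2) := by
    rw [show (fun i => gammaMeasure (β i) γ) = fun i => volume.withDensity (gammaPDF (β i) γ)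
      from rfl]
    have : ∀ i, SigmaFinite ((volume : Measure ℝ).withDensity (gammaPDF (β i) γ)) := fun i =>
      inferInstanceAs (SigmaFinite (gammaMeasure (β i) γ))
    rw [pi_withDensity fun i => measurable_gammaPDF (β i) γ, gammaMeasure]
    have : SFinite ((volume : Measure ℝ).withDensity (gammaPDF b γ)) :=
      inferInstanceAs (SFinite (gammaMeasure b γ))
    rw [prod_withDensity _ (measurable_gammaPDF b γ)]
    · rfl
    · exact Finset.measurable_prod _ fun i _ =>
        (measurable_gammaPDF (β i) γ).comp (measurable_pi_apply i)
  have hmeas2 : Measurable fun z : (ι → ℝ) × ℝ =>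
      (∏ i, gammaPDF (β i) γ (z.1 i)) * gammaPDF b γ z.2 :=
    (Finset.measurable_prod _ fun i _ =>
        (measurable_gammaPDF (β i) γ).comp ((measurable_pi_apply i).comp measurable_fst)).mul
      ((measurable_gammaPDF b γ).comp measurable_snd)
  rw [step1, hswap, hprod, lintegral_withDensity_eq_lintegral_mul _ hmeas2 hΦ, lintegral_prod]
  swap
  · exact (hmeas2.mul hΦ).aemeasurable
  have hy0 : ∀ᵐ y : ι → ℝ, ∀ i, y i ≠ 0 := by
    refine ae_all_iff.2 fun i => ?_
    exact Measure.ae_eval_ne (μ := fun _ : ι => (volume : Measure ℝ)) i 0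
  refine lintegral_congr_ae (hy0.mono fun y hy => ?_)
  dsimp only
  -- Translation of `r` for fixed `y`: the new variable `s = r - ∑ i, y i` is the remaining mass.
  rw [← lintegral_add_right_eq_self _ (∑ i, y i)]
  have hs0 : ∀ᵐ r : ℝ, r ≠ 0 := by simp [ae_iff]
  refine lintegral_congr_ae (hs0.mono fun s hs => ?_)
  simp only [add_sub_cancel_right, Pi.mul_apply]
  congr 1
  by_cases hpos : ∀ i, 0 < y i
  · have hY : 0 ≤ ∑ i, y i := Finset.sum_nonneg fun i _ => (hpos i).le
    -- For `s < 0` and `r > 0` the coordinates `y i / r` sum to more than one, so the Dirichlet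
    -- density vanishes together with the Gamma density of `s`.
    rcases lt_or_gt_of_ne hs with hs | hs
    · rw [gammaPDF_of_neg hs, mul_zero]
      simp only [H]
      split_ifs with hr
      · rw [dirichletDensity, if_neg, mul_zero, mul_zero]
        rintro ⟨-, h⟩
        simp only [Pi.smul_apply, smul_eq_mul] at h
        rw [← Finset.mul_sum, inv_mul_lt_iff₀ hr] at h
        linarith
      · rfl
    · have hr : 0 < s + ∑ i, y i := by linarith
      simp only [H, if_pos hr]
      exact gammaPDF_mul_dirichletDensity hβ hb hγ hpos hs
  · obtain ⟨i, hi⟩ := not_forall.1 hpos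
    have hi' : y i < 0 := lt_of_le_of_ne (not_lt.1 hi) (hy i)
    rw [Finset.prod_eq_zero (Finset.mem_univ i) (gammaPDF_of_neg hi'), zero_mul]
    simp only [H]
    split_ifs with hr
    · rw [dirichletDensity, if_neg, mul_zero, mul_zero]
      rintro ⟨h, -⟩
      have := h i
      simp only [Pi.smul_apply, smul_eq_mul] at this
      exact hi ((mul_pos_iff_of_pos_left (inv_pos.2 hr)).1 this)
    · rfl

end GammaDirichlet

/-! ### Moments and characteristic functions of Gamma distributions. -/

section Gamma

variable {a γ : ℝ}

lemma gammaMeasure_nonneg (a γ : ℝ) : ∀ᵐ x ∂gammaMeasure a γ, 0 ≤ x := by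
  rw [gammaMeasure, ae_withDensity_iff (measurable_gammaPDF a γ)]
  refine ae_of_all _ fun x hx => ?_
  by_contra h
  exact hx (gammaPDF_of_neg (not_le.1 h))

/-- Size-biasing raises the shape by one, since `Γ(a + 1) = a Γ(a)`. Iterating this gives the first
two moments. -/
lemma lintegral_mul_gammaMeasure (ha : 0 < a) (hγ : 0 < γ) {f : ℝ → ℝ≥0∞} (hf : Measurable f) :
    ∫⁻ x, ENNReal.ofReal x * f x ∂gammaMeasure a γ =
      ENNReal.ofReal (a / γ) * ∫⁻ x, f x ∂gammaMeasure (a + 1) γ := by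
  rw [gammaMeasure, gammaMeasure, lintegral_withDensity_eq_lintegral_mul _
    (measurable_gammaPDF _ _) (by fun_prop), lintegral_withDensity_eq_lintegral_mul _
    (measurable_gammaPDF _ _) hf, ← lintegral_const_mul _ ((measurable_gammaPDF _ _).mul hf)]
  have h0 : ∀ᵐ r : ℝ, r ≠ 0 := by simp [ae_iff]
  refine lintegral_congr_ae (h0.mono fun x hx => ?_)
  simp only [Pi.mul_apply]
  rw [← mul_assoc, ← mul_assoc]
  congr 1
  rcases lt_or_gt_of_ne hx with hx | hx
  · simp [gammaPDF_of_neg hx]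
  · have hG := Real.Gamma_pos_of_pos ha
    rw [gammaPDF_of_nonneg hx.le, gammaPDF_of_nonneg hx.le, ← ENNReal.ofReal_mul (by positivity),
      ← ENNReal.ofReal_mul (by positivity), Real.Gamma_add_one ha.ne', Real.rpow_add_one hγ.ne',
      add_sub_right_comm, Real.rpow_add_one hx.ne']
    congr 1
    field_simp

/-- Exponential tilting by `t` turns the rate `γ` into `γ - t`, and the normalising constants leave
the factor `(1 - t / γ) ^ (-a)`. -/
lemma lintegral_exp_gammaMeasure (ha : 0 < a) (hγ : 0 < γ) {t : ℝ} (ht : t < γ) :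
    ∫⁻ x, ENNReal.ofReal (Real.exp (t * x)) ∂gammaMeasure a γ =
      ENNReal.ofReal ((1 - t / γ) ^ (-a)) := by
  have hγt : 0 < γ - t := by linarith
  have := isProbabilityMeasure_gammaMeasure ha hγt
  rw [← mul_one (ENNReal.ofReal ((1 - t / γ) ^ (-a))),
    ← measure_univ (μ := gammaMeasure a (γ - t)), ← lintegral_one, gammaMeasure, gammaMeasure,
    lintegral_withDensity_eq_lintegral_mul _ (measurable_gammaPDF _ _) (by fun_prop),
    lintegral_withDensity_eq_lintegral_mul _ (measurable_gammaPDF _ _) (by fun_prop),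
    ← lintegral_const_mul _ ((measurable_gammaPDF _ _).mul measurable_const)]
  refine lintegral_congr fun x => ?_
  simp only [Pi.mul_apply, mul_one]
  rcases lt_or_ge x 0 with hx | hx
  · simp [gammaPDF_of_neg hx]
  · have hG := Real.Gamma_pos_of_pos ha
    have h1 : 1 - t / γ = (γ - t) / γ := by field_simp
    have h1' : 0 < 1 - t / γ := by rw [h1]; positivity
    rw [gammaPDF_of_nonneg hx, gammaPDF_of_nonneg hx, ← ENNReal.ofReal_mul (by positivity),
      ← ENNReal.ofReal_mul (by positivity)]
    congr 1
    have h2 : Real.exp (-((γ - t) * x)) = Real.exp (-(γ * x)) * Real.exp (t * x) := by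
      rw [← Real.exp_add]; ring_nf
    have h3 : (γ - t) ^ a = (1 - t / γ) ^ a * γ ^ a := by
      rw [← Real.mul_rpow h1'.le hγ.le, h1, div_mul_cancel₀ _ hγ.ne']
    have h4 : (1 - t / γ) ^ a ≠ 0 := (Real.rpow_pos_of_pos h1' a).ne'
    rw [h2, h3, Real.rpow_neg h1'.le]
    field_simp

lemma integrable_exp_gammaMeasure (ha : 0 < a) (hγ : 0 < γ) {t : ℝ} (ht : t < γ) :
    Integrable (fun x => Real.exp (t * x)) (gammaMeasure a γ) := by
  refine ⟨by fun_prop, ?_⟩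
  rw [hasFiniteIntegral_iff_ofReal (ae_of_all _ fun x => (Real.exp_pos _).le),
    lintegral_exp_gammaMeasure ha hγ ht]
  exact ENNReal.ofReal_lt_top

lemma mgf_gammaMeasure (ha : 0 < a) (hγ : 0 < γ) {t : ℝ} (ht : t < γ) :
    mgf id (gammaMeasure a γ) t = (1 - t / γ) ^ (-a) := by
  have h1 : 0 < 1 - t / γ := by rw [sub_pos, div_lt_one hγ]; exact ht
  simp only [mgf, id]
  rw [integral_eq_lintegral_of_nonneg_ae (ae_of_all _ fun x => (Real.exp_pos _).le)
    (by fun_prop), lintegral_exp_gammaMeasure ha hγ ht, ENNReal.toReal_ofReal (by positivity)]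

/-- The characteristic function of the Gamma distribution with shape `a` and rate `γ`. -/
noncomputable def gammaChar (γ a t : ℝ) : ℂ := (1 - t / γ * Complex.I) ^ (-a : ℂ)

lemma one_sub_mem_slitPlane {z : ℂ} (hz : z.re < 1) : 1 - z ∈ Complex.slitPlane := by
  refine Or.inl ?_
  simp [hz]

lemma one_sub_mul_I_ne_zero (x : ℝ) : (1 - x * Complex.I : ℂ) ≠ 0 :=
  Complex.slitPlane_ne_zero (one_sub_mem_slitPlane (by simp))

/-- With the value `1` at shape zero, coordinates with vanishing parameter can be kept in products
of characteristic functions. -/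
lemma gammaChar_zero_left (t : ℝ) : gammaChar γ 0 t = 1 := by simp [gammaChar]

lemma gammaChar_zero_right : gammaChar γ a 0 = 1 := by simp [gammaChar]

lemma gammaChar_ne_zero (γ t : ℝ) : (1 - t / γ * Complex.I : ℂ) ≠ 0 := by
  exact_mod_cast one_sub_mul_I_ne_zero (t / γ)

lemma gammaChar_sum {ι : Type*} (s : Finset ι) (β : ι → ℝ) (t : ℝ) :
    ∏ i ∈ s, gammaChar γ (β i) t = gammaChar γ (∑ i ∈ s, β i) t := by
  classical
  induction s using Finset.induction_on with
  | empty => simp [gammaChar_zero_left]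
  | insert i s hi ih =>
    rw [Finset.prod_insert hi, Finset.sum_insert hi, ih, gammaChar, gammaChar, gammaChar,
      ← Complex.cpow_add _ _ (gammaChar_ne_zero γ t)]
    congr 1
    push_cast
    ring

/-- Continuity in the shape is what allows the passage from finitely many donors to all of them. -/
lemma continuous_gammaChar (γ t : ℝ) : Continuous fun a => gammaChar γ a t := by
  unfold gammaChar
  exact Continuous.const_cpow (by fun_prop) (Or.inl (gammaChar_ne_zero γ t))

theorem charFun_gammaMeasure (ha : 0 < a) (hγ : 0 < γ) (t : ℝ) :
    charFun (gammaMeasure a γ) t = gammaChar γ a t := by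
  have hsub : Set.Iio γ ⊆ interior (integrableExpSet id (gammaMeasure a γ)) :=
    interior_maximal (fun s hs => integrable_exp_gammaMeasure ha hγ hs) isOpen_Iio
  have hU : {z : ℂ | z.re < γ} ⊆
      {z | z.re ∈ interior (integrableExpSet id (gammaMeasure a γ))} := fun z hz => hsub hz
  have h1 : AnalyticOnNhd ℂ (complexMGF id (gammaMeasure a γ)) {z : ℂ | z.re < γ} :=
    analyticOnNhd_complexMGF.mono hU
  have hre : ∀ z : ℂ, (z / γ).re = z.re / γ := fun z => Complex.div_ofReal_re z γ
  have h2 : AnalyticOnNhd ℂ (fun z : ℂ => (1 - z / γ) ^ (-a : ℂ)) {z : ℂ | z.re < γ} := by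
    refine DifferentiableOn.analyticOnNhd (fun z hz => ?_)
      (isOpen_Iio.preimage Complex.continuous_re)
    refine DifferentiableAt.differentiableWithinAt ?_
    refine DifferentiableAt.cpow_const (by fun_prop) (one_sub_mem_slitPlane ?_)
    rw [hre, div_lt_one hγ]
    exact hz
  have hpre : IsPreconnected {z : ℂ | z.re < γ} := (convex_halfSpace_re_lt γ).isPreconnected
  -- Both sides are analytic on the half-plane `re z < γ` and agree at the real points `-1 / (n +
  -- 1)`, which accumulate at `0`; the identity theorem then reaches the imaginary axis.
  have heq := h1.eqOn_of_preconnected_of_frequently_eq h2 hpre (z₀ := 0) (by simpa using hγ) (by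
    have hlim : Tendsto (fun n : ℕ => ((-(1 / ((n : ℝ) + 1)) : ℝ) : ℂ)) atTop (𝓝[≠] 0) := by
      rw [tendsto_nhdsWithin_iff]
      refine ⟨?_, Eventually.of_forall fun n => ?_⟩
      · have h := (tendsto_one_div_add_atTop_nhds_zero_nat (𝕜 := ℝ)).neg
        rw [neg_zero] at h
        have h' := (Complex.continuous_ofReal.tendsto 0).comp h
        simpa [Function.comp_def] using h'
      · simp only [Set.mem_compl_iff, Set.mem_singleton_iff, Complex.ofReal_eq_zero]
        have : (0 : ℝ) < 1 / ((n : ℝ) + 1) := by positivity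
        linarith
    refine hlim.frequently (Frequently.of_forall fun n => ?_)
    set s : ℝ := -(1 / ((n : ℝ) + 1)) with hs
    have hs0 : s < 0 := by
      have : (0 : ℝ) < 1 / ((n : ℝ) + 1) := by positivity
      rw [hs]; linarith
    have hsγ : s < γ := hs0.trans hγ
    have h3 : 0 ≤ 1 - s / γ := by
      rw [sub_nonneg, div_le_one hγ]; exact hsγ.le
    rw [complexMGF_ofReal, mgf_gammaMeasure ha hγ hsγ, Complex.ofReal_cpow h3]
    push_cast
    rfl)
  rw [← complexMGF_id_mul_I]
  have := heq (x := t * Complex.I) (by simpa using hγ)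
  simp only [this, gammaChar, mul_div_right_comm]

lemma integral_id_gammaMeasure (ha : 0 < a) (hγ : 0 < γ) : ∫ x, x ∂gammaMeasure a γ = a / γ := by
  have h := lintegral_mul_gammaMeasure ha hγ (f := fun _ => 1) measurable_const
  have := isProbabilityMeasure_gammaMeasure (show 0 < a + 1 by linarith) hγ
  simp only [mul_one, lintegral_one, measure_univ] at h
  rw [integral_eq_lintegral_of_nonneg_ae (gammaMeasure_nonneg a γ) (by fun_prop), h,
    ENNReal.toReal_ofReal (by positivity)]

lemma lintegral_sq_gammaMeasure (ha : 0 < a) (hγ : 0 < γ) :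
    ∫⁻ x, ENNReal.ofReal (x ^ 2) ∂gammaMeasure a γ = ENNReal.ofReal (a * (a + 1) / γ ^ 2) := by
  have h := lintegral_mul_gammaMeasure ha hγ (f := ENNReal.ofReal) ENNReal.measurable_ofReal
  have h' := lintegral_mul_gammaMeasure (show 0 < a + 1 by linarith) hγ (f := fun _ => 1)
    measurable_const
  have := isProbabilityMeasure_gammaMeasure (show 0 < a + 1 + 1 by linarith) hγ
  simp only [mul_one, lintegral_one, measure_univ] at h'
  rw [h', ← ENNReal.ofReal_mul (by positivity)] at h
  rw [show a * (a + 1) / γ ^ 2 = a / γ * ((a + 1) / γ) by field_simp, ← h]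
  refine lintegral_congr_ae ((gammaMeasure_nonneg a γ).mono fun x hx => ?_)
  simp only
  rw [sq, ENNReal.ofReal_mul hx]

lemma integral_sq_gammaMeasure (ha : 0 < a) (hγ : 0 < γ) :
    ∫ x, x ^ 2 ∂gammaMeasure a γ = a * (a + 1) / γ ^ 2 := by
  rw [integral_eq_lintegral_of_nonneg_ae (ae_of_all _ fun x => sq_nonneg x) (by fun_prop),
    lintegral_sq_gammaMeasure ha hγ, ENNReal.toReal_ofReal (by positivity)]

lemma memLp_two_gammaMeasure (ha : 0 < a) (hγ : 0 < γ) :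
    MemLp (fun x : ℝ => x) 2 (gammaMeasure a γ) := by
  rw [memLp_two_iff_integrable_sq (by fun_prop)]
  refine ⟨by fun_prop, ?_⟩
  rw [hasFiniteIntegral_iff_ofReal (ae_of_all _ fun x => sq_nonneg x),
    lintegral_sq_gammaMeasure ha hγ]
  exact ENNReal.ofReal_lt_top

lemma isMassLaw_gammaMeasure (ha : 0 < a) (hγ : 0 < γ) : IsMassLaw (gammaMeasure a γ) where
  isProbabilityMeasure := isProbabilityMeasure_gammaMeasure ha hγ
  nonneg := gammaMeasure_nonneg a γ
  memLp_two := memLp_two_gammaMeasure ha hγ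
  mean_pos := by rw [integral_id_gammaMeasure ha hγ]; positivity

lemma gammaMeasure_map_const_mul (ha : 0 < a) (hγ : 0 < γ) {c : ℝ} (hc : 0 < c) :
    (gammaMeasure a γ).map (c * ·) = gammaMeasure a (γ / c) := by
  have := isProbabilityMeasure_gammaMeasure ha hγ
  have := isProbabilityMeasure_gammaMeasure ha (div_pos hγ hc)
  have : IsProbabilityMeasure ((gammaMeasure a γ).map (c * ·)) :=
    Measure.isProbabilityMeasure_map (by fun_prop)
  refine Measure.ext_of_charFun (funext fun t => ?_)
  rw [charFun_map_mul, charFun_gammaMeasure ha hγ, charFun_gammaMeasure ha (div_pos hγ hc),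
    gammaChar, gammaChar]
  congr 3
  push_cast
  have : (c : ℂ) ≠ 0 := by exact_mod_cast hc.ne'
  field_simp

end Gamma

/-! ### Infinite Dirichlet vectors: characteristic functions and second moments. -/

section Dirichlet

variable {α : ℤ → ℝ} {a γ : ℝ} {ρ : Measure (ℤ → ℝ)}

/-- The joint law of the components of a Dirichlet vector with indices in `F`, and of the rest,
multiplied by an independent Gamma variable. -/
theorem IsDirichlet.map_gamma_mul (hρ : IsDirichlet α ρ) (hsum : HasSum α a) (hγ : 0 < γ)
    {F : Finset ℤ} (hF : ∀ i ∈ F, 0 < α i) (hFa : ∑ i ∈ F, α i < a) :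
    ((gammaMeasure a γ).prod ρ).map
        (fun z => ((fun i : F => z.1 * z.2 i), z.1 - ∑ i ∈ F, z.1 * z.2 i)) =
      (Measure.pi fun i : F => gammaMeasure (α i) γ).prod
        (gammaMeasure (a - ∑ i ∈ F, α i) γ) := by
  have hlaw := hρ.map_restrict F hF (by rwa [hsum.tsum_eq])
  have := hρ.isProbabilityMeasure
  refine Measure.ext_of_lintegral _ fun Φ hΦ => ?_
  rw [lintegral_map hΦ (by fun_prop), lintegral_prod _ (by fun_prop),
    ← lintegral_gamma_mul_dirichlet (fun i : F => hF i i.2) (sub_pos.2 hFa) hγ hΦ]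
  have hs : ∑ i : F, α i = ∑ i ∈ F, α i := Finset.sum_coe_sort F α
  rw [hsum.tsum_eq] at hlaw
  rw [hs, add_sub_cancel, ← hlaw]
  refine lintegral_congr fun r => ?_
  rw [lintegral_map (by fun_prop) (by fun_prop)]
  refine lintegral_congr fun p => ?_
  congr 2
  rw [← Finset.sum_coe_sort F]
  rfl

lemma IsDirichlet.ae_sum_eq_one (hρ : IsDirichlet α ρ) (hα : ∀ i, 0 ≤ α i) (hsum : HasSum α a)
    {J : Finset ℤ} (hJ : ∑ i ∈ J, α i = a) : ∀ᵐ p ∂ρ, ∑ i ∈ J, p i = 1 := by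
  have hzero : ∀ i, i ∉ J → α i = 0 := by
    intro i hi
    have h := sum_le_hasSum (insert i J) (fun j _ => hα j) hsum
    rw [Finset.sum_insert hi, hJ] at h
    exact le_antisymm (by linarith) (hα i)
  have h : ∀ᵐ p ∂ρ, ∀ i, α i = 0 → p i = 0 := by
    refine ae_all_iff.2 fun i => ?_
    by_cases hi : α i = 0
    · exact (hρ.eq_zero i hi).mono fun p hp _ => hp
    · exact ae_of_all _ fun p hp => absurd hp hi
  filter_upwards [h, hρ.hasSum_one] with p hp h1
  exact (hasSum_sum_of_ne_finset_zero fun i hi => hp i (hzero i hi)).unique h1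

lemma integral_cexp_gammaMeasure {b : ℝ} (hb : 0 < b) (hγ : 0 < γ) (t : ℝ) :
    ∫ x, Complex.exp ((t * x : ℝ) * Complex.I) ∂gammaMeasure b γ = gammaChar γ b t := by
  rw [← charFun_gammaMeasure hb hγ, charFun_apply_real]
  push_cast
  rfl

/-- The remainder gets its own frequency `u`: the choice `u = 0` forgets it, and another choice lets
it stand for one further coordinate. -/
lemma IsDirichlet.integral_cexp_restrict (hρ : IsDirichlet α ρ) (hsum : HasSum α a) (hγ : 0 < γ)
    {F : Finset ℤ} (hF : ∀ i ∈ F, 0 < α i) (hFa : ∑ i ∈ F, α i < a) (t : ℤ → ℝ) (u : ℝ) :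
    ∫ z, Complex.exp ((∑ i ∈ F, t i * (z.1 * z.2 i) + u * (z.1 - ∑ i ∈ F, z.1 * z.2 i) : ℝ)
        * Complex.I) ∂((gammaMeasure a γ).prod ρ) =
      (∏ i ∈ F, gammaChar γ (α i) (t i)) * gammaChar γ (a - ∑ i ∈ F, α i) u := by
  have hb := sub_pos.2 hFa
  have hpr : ∀ i : F, IsProbabilityMeasure (gammaMeasure (α i) γ) := fun i =>
    isProbabilityMeasure_gammaMeasure (hF i i.2) hγ
  have := isProbabilityMeasure_gammaMeasure hb hγ
  have h := hρ.map_gamma_mul hsum hγ hF hFa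
  have h1 : ∫ w : (F → ℝ) × ℝ, Complex.exp ((∑ i : F, t i * w.1 i + u * w.2 : ℝ) * Complex.I)
      ∂((Measure.pi fun i : F => gammaMeasure (α i) γ).prod
        (gammaMeasure (a - ∑ i ∈ F, α i) γ)) =
      (∏ i ∈ F, gammaChar γ (α i) (t i)) * gammaChar γ (a - ∑ i ∈ F, α i) u := by
    rw [← Finset.prod_coe_sort F, ← integral_cexp_gammaMeasure hb hγ]
    simp_rw [fun i : F => (integral_cexp_gammaMeasure (hF i i.2) hγ (t i)).symm]
    rw [← integral_fintype_prod_eq_prod (𝕜 := ℂ)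
      (f := fun (i : F) (x : ℝ) => Complex.exp ((t i * x : ℝ) * Complex.I)), ← integral_prod_mul]
    congr 1
    ext w
    rw [← Complex.exp_sum, ← Complex.exp_add]
    congr 1
    push_cast
    rw [← Finset.sum_mul, ← add_mul]
  rw [← h1, ← h, integral_map (by fun_prop) (by fun_prop)]
  congr 1
  ext z
  rw [← Finset.sum_coe_sort F]

/-- This is the Gamma–Dirichlet identity in a form valid for every finite index set, including sets
that contain zero parameters or exhaust the total parameter. -/
theorem IsDirichlet.integral_cexp (hρ : IsDirichlet α ρ) (hα : ∀ i, 0 ≤ α i) (hsum : HasSum α a)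
    (ha : 0 < a) (hγ : 0 < γ) (J : Finset ℤ) (t : ℤ → ℝ) :
    ∫ z, Complex.exp ((∑ i ∈ J, t i * (z.1 * z.2 i) : ℝ) * Complex.I)
        ∂((gammaMeasure a γ).prod ρ) = ∏ i ∈ J, gammaChar γ (α i) (t i) := by
  classical
  have := hρ.isProbabilityMeasure
  have := isProbabilityMeasure_gammaMeasure ha hγ
  have hsnd {P : (ℤ → ℝ) → Prop} (hP : ∀ᵐ p ∂ρ, P p) :
      ∀ᵐ z ∂((gammaMeasure a γ).prod ρ), P z.2 := Measure.quasiMeasurePreserving_snd.ae hP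
  set K := J.filter fun i => 0 < α i with hK
  have hnot : ∀ i ∈ J, i ∉ K → α i = 0 := fun i hi hiK =>
    le_antisymm (not_lt.1 fun h => hiK (Finset.mem_filter.2 ⟨hi, h⟩)) (hα i)
  have hKpos : ∀ i ∈ K, 0 < α i := fun i hi => (Finset.mem_filter.1 hi).2
  have hprod : ∏ i ∈ J, gammaChar γ (α i) (t i) = ∏ i ∈ K, gammaChar γ (α i) (t i) :=
    (Finset.prod_subset (Finset.filter_subset _ _) fun i hi hiK => by
      rw [hnot i hi hiK, gammaChar_zero_left]).symm
  have hzero : ∀ᵐ p ∂ρ, ∀ i, α i = 0 → p i = 0 := by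
    refine ae_all_iff.2 fun i => ?_
    by_cases hi : α i = 0
    · exact (hρ.eq_zero i hi).mono fun p hp _ => hp
    · exact ae_of_all _ fun p hp => absurd hp hi
  have hint : ∫ z, Complex.exp ((∑ i ∈ J, t i * (z.1 * z.2 i) : ℝ) * Complex.I)
        ∂((gammaMeasure a γ).prod ρ) =
      ∫ z, Complex.exp ((∑ i ∈ K, t i * (z.1 * z.2 i) : ℝ) * Complex.I)
        ∂((gammaMeasure a γ).prod ρ) := by
    refine integral_congr_ae ((hsnd hzero).mono fun z hz => ?_)
    simp only
    rw [Finset.sum_subset (Finset.filter_subset _ _) fun i hi hiK => by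
      rw [hz i (hnot i hi hiK), mul_zero, mul_zero]]
  rw [hprod, hint]
  rcases (sum_le_hasSum K (fun i _ => hα i) hsum).lt_or_eq with hlt | heq
  · have h := hρ.integral_cexp_restrict hsum hγ hKpos hlt t 0
    rw [gammaChar_zero_right, mul_one] at h
    simpa only [zero_mul, add_zero] using h
  -- If `K` carries the whole parameter, the law of the vector is only available on proper subsets.
  -- One index `k` is removed, and the remainder is almost surely the coordinate `k`.
  · have hne : K.Nonempty := by
      rw [Finset.nonempty_iff_ne_empty]
      rintro h
      rw [h, Finset.sum_empty] at heq
      exact ha.ne heq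
    obtain ⟨k, hk⟩ := hne
    have hsplit (f : ℤ → ℝ) : ∑ i ∈ K, f i = ∑ i ∈ K.erase k, f i + f k :=
      (Finset.sum_erase_add _ _ hk).symm
    have hpos : ∀ i ∈ K.erase k, 0 < α i := fun i hi => hKpos i (Finset.mem_of_mem_erase hi)
    have heq' := hsplit α
    have hlt : ∑ i ∈ K.erase k, α i < a := by
      have := hKpos k hk
      linarith
    have h := hρ.integral_cexp_restrict hsum hγ hpos hlt t (t k)
    rw [show a - ∑ i ∈ K.erase k, α i = α k by linarith,
      Finset.prod_erase_mul K (fun i => gammaChar γ (α i) (t i)) hk] at h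
    rw [← h]
    refine integral_congr_ae ((hsnd (hρ.ae_sum_eq_one hα hsum heq)).mono fun z hz => ?_)
    simp only
    congr 3
    have h1 := hsplit z.2
    rw [hz] at h1
    rw [hsplit, ← Finset.mul_sum, show z.2 k = 1 - ∑ i ∈ K.erase k, z.2 i by linarith]
    ring

lemma integral_gamma_prod_mul (a γ : ℝ) (ha : 0 < a) (hγ : 0 < γ) [IsProbabilityMeasure ρ]
    (f : (ℤ → ℝ) → ℝ) :
    ∫ z, z.1 * f z.2 ∂((gammaMeasure a γ).prod ρ) = a / γ * ∫ p, f p ∂ρ := by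
  have := isProbabilityMeasure_gammaMeasure ha hγ
  rw [integral_prod_mul (fun x : ℝ => x) f, integral_id_gammaMeasure ha hγ]

/-- By independence, second moments of `p` are those of the Gamma variables `R * p k` divided by the
second moment of `R`. -/
lemma integral_gamma_sq_prod_mul (a γ : ℝ) (ha : 0 < a) (hγ : 0 < γ) [IsProbabilityMeasure ρ]
    (f : (ℤ → ℝ) → ℝ) :
    ∫ z, z.1 ^ 2 * f z.2 ∂((gammaMeasure a γ).prod ρ) = a * (a + 1) / γ ^ 2 * ∫ p, f p ∂ρ := by
  have := isProbabilityMeasure_gammaMeasure ha hγ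
  rw [integral_prod_mul (fun x : ℝ => x ^ 2) f, integral_sq_gammaMeasure ha hγ]

variable (hα : ∀ i, 0 ≤ α i) (hsum : HasSum α a) (htwo : ∃ i j, i ≠ j ∧ 0 < α i ∧ 0 < α j)
include hα hsum htwo

lemma lt_total (k : ℤ) : α k < a := by
  obtain ⟨i, j, hij, hi, hj⟩ := htwo
  by_cases h : i = k
  · have := sum_le_hasSum {k, j} (fun i _ => hα i) hsum
    rw [Finset.sum_pair (h ▸ hij)] at this
    linarith
  · have := sum_le_hasSum {k, i} (fun i _ => hα i) hsum
    rw [Finset.sum_pair (Ne.symm h)] at this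
    linarith

lemma total_pos : 0 < a := (hα 0).trans_lt (lt_total hα hsum htwo 0)

/-- The law of one coordinate of a Dirichlet vector times an independent Gamma variable. -/
lemma IsDirichlet.map_gamma_mul_apply (hρ : IsDirichlet α ρ) (hγ : 0 < γ) {k : ℤ}
    (hk : 0 < α k) : ((gammaMeasure a γ).prod ρ).map (fun z => z.1 * z.2 k) =
      gammaMeasure (α k) γ := by
  have hlt := lt_total hα hsum htwo k
  have ha := total_pos hα hsum htwo
  have := hρ.isProbabilityMeasure
  have := isProbabilityMeasure_gammaMeasure ha hγ
  have := isProbabilityMeasure_gammaMeasure hk hγ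
  have : IsProbabilityMeasure (((gammaMeasure a γ).prod ρ).map (fun z => z.1 * z.2 k)) :=
    Measure.isProbabilityMeasure_map (by fun_prop)
  refine Measure.ext_of_charFun (funext fun t => ?_)
  rw [charFun_gammaMeasure hk hγ, charFun_apply_real, integral_map (by fun_prop) (by fun_prop)]
  have h := hρ.integral_cexp hα hsum ha hγ {k} (fun _ => t)
  simpa using h

lemma IsDirichlet.integral_apply (hρ : IsDirichlet α ρ) (k : ℤ) : ∫ p, p k ∂ρ = α k / a := by
  have ha := total_pos hα hsum htwo
  have := hρ.isProbabilityMeasure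
  rcases (hα k).eq_or_lt with h | h
  · rw [← h, zero_div, integral_eq_zero_of_ae (hρ.eq_zero k h.symm)]
  · have h1 := integral_gamma_prod_mul (ρ := ρ) a 1 ha one_pos (fun p => p k)
    have h2 := hρ.map_gamma_mul_apply hα hsum htwo one_pos h
    have h3 := integral_id_gammaMeasure h one_pos
    rw [← h2, integral_map (by fun_prop) (by fun_prop), h1] at h3
    field_simp at h3 ⊢
    linarith

lemma IsDirichlet.integral_sq_apply (hρ : IsDirichlet α ρ) (k : ℤ) :
    ∫ p, p k ^ 2 ∂ρ = α k * (α k + 1) / (a * (a + 1)) := by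
  have ha := total_pos hα hsum htwo
  have := hρ.isProbabilityMeasure
  rcases (hα k).eq_or_lt with h | h
  · rw [← h, zero_mul, zero_div, integral_eq_zero_of_ae]
    exact (hρ.eq_zero k h.symm).mono fun p hp => by simp [hp]
  · have h1 := integral_gamma_sq_prod_mul (ρ := ρ) a 1 ha one_pos (fun p => p k ^ 2)
    have h2 := hρ.map_gamma_mul_apply hα hsum htwo one_pos h
    have h3 := integral_sq_gammaMeasure h one_pos
    rw [← h2, integral_map (by fun_prop) (by fun_prop)] at h3
    simp only [mul_pow] at h3
    rw [h1] at h3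
    field_simp at h3 ⊢
    linarith

lemma IsDirichlet.integral_mul_apply (hρ : IsDirichlet α ρ) {j k : ℤ} (hjk : j ≠ k) :
    ∫ p, p j * p k ∂ρ = α j * α k / (a * (a + 1)) := by
  have ha := total_pos hα hsum htwo
  have := hρ.isProbabilityMeasure
  rcases (hα j).eq_or_lt with hj | hj
  · rw [← hj, zero_mul, zero_div, integral_eq_zero_of_ae]
    exact (hρ.eq_zero j hj.symm).mono fun p hp => by simp [hp]
  rcases (hα k).eq_or_lt with hk | hk
  · rw [← hk, mul_zero, zero_div, integral_eq_zero_of_ae]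
    exact (hρ.eq_zero k hk.symm).mono fun p hp => by simp [hp]
  have hpair (f : ℤ → ℝ) : ∑ i ∈ {j, k}, f i = f j + f k := Finset.sum_pair hjk
  rcases (sum_le_hasSum {j, k} (fun i _ => hα i) hsum).lt_or_eq with hlt | heq
  · have hpos : ∀ i ∈ ({j, k} : Finset ℤ), 0 < α i := by
      intro i hi
      rcases Finset.mem_insert.1 hi with rfl | hi
      · exact hj
      · rwa [Finset.mem_singleton.1 hi]
    have h1 := integral_gamma_sq_prod_mul (ρ := ρ) a 1 ha one_pos (fun p => p j * p k)
    have h2 := hρ.map_gamma_mul hsum one_pos hpos hlt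
    have hpr : ∀ i : ({j, k} : Finset ℤ), IsProbabilityMeasure (gammaMeasure (α i) 1) := fun i =>
      isProbabilityMeasure_gammaMeasure (hpos i i.2) one_pos
    have := isProbabilityMeasure_gammaMeasure (sub_pos.2 hlt) one_pos
    set J : ({j, k} : Finset ℤ) := ⟨j, by simp⟩
    set K : ({j, k} : Finset ℤ) := ⟨k, by simp⟩
    have hJK : J ≠ K := fun h => hjk (congrArg Subtype.val h)
    have h3 : ∫ y, y J * y K ∂(Measure.pi fun i : ({j, k} : Finset ℤ) => gammaMeasure (α i) 1) =
        α j * α k := by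
      have hind := (iIndepFun_pi (μ := fun i : ({j, k} : Finset ℤ) => gammaMeasure (α i) 1)
        (X := fun _ x => x) fun i => aemeasurable_id).indepFun hJK
      have h4 := hind.integral_fun_mul_eq_mul_integral
        (measurable_pi_apply J).aestronglyMeasurable (measurable_pi_apply K).aestronglyMeasurable
      rw [h4]
      have h5 (i : ({j, k} : Finset ℤ)) : ∫ y, y i
          ∂(Measure.pi fun i : ({j, k} : Finset ℤ) => gammaMeasure (α i) 1) = α i := by
        have h6 := (measurePreserving_eval
          (fun i : ({j, k} : Finset ℤ) => gammaMeasure (α i) 1) i).map_eq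
        have h7 := integral_id_gammaMeasure (hpos i i.2) one_pos
        rw [← h6, integral_map (measurable_pi_apply i).aemeasurable (by fun_prop), div_one] at h7
        exact h7
      rw [h5, h5]
    have h4 : ∫ w, w.1 J * w.1 K ∂((Measure.pi fun i : ({j, k} : Finset ℤ) =>
        gammaMeasure (α i) 1).prod (gammaMeasure (a - ∑ i ∈ {j, k}, α i) 1)) = α j * α k := by
      rw [integral_fun_fst (fun y : ({j, k} : Finset ℤ) → ℝ => y J * y K), h3]
      simp
    rw [← h2, integral_map (by fun_prop) (by fun_prop)] at h4
    have h5 : ∀ z : ℝ × (ℤ → ℝ), z.1 * z.2 J * (z.1 * z.2 K) = z.1 ^ 2 * (z.2 j * z.2 k) :=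
      fun z => by simp only [J, K]; ring
    simp only [h5] at h4
    rw [h1] at h4
    field_simp at h4 ⊢
    linarith
  -- If `j` and `k` carry the whole parameter, then `p k = 1 - p j` almost surely, and the moments
  -- of one coordinate suffice.
  · have h1 := hρ.ae_sum_eq_one hα hsum heq
    rw [hpair] at heq
    have hint (i : ℤ) : Integrable (fun p : ℤ → ℝ => p i) ρ := by
      refine Integrable.of_bound (measurable_pi_apply i).aestronglyMeasurable 1 ?_
      filter_upwards [hρ.nonneg, hρ.hasSum_one] with p hp hs
      rw [Real.norm_of_nonneg (hp i)]
      exact le_hasSum hs i fun j _ => hp j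
    have hint2 : Integrable (fun p : ℤ → ℝ => p j ^ 2) ρ := by
      refine Integrable.of_bound ((measurable_pi_apply j).pow_const 2).aestronglyMeasurable 1 ?_
      filter_upwards [hρ.nonneg, hρ.hasSum_one] with p hp hs
      rw [Real.norm_of_nonneg (sq_nonneg _)]
      exact pow_le_one₀ (hp j) (le_hasSum hs j fun j _ => hp j)
    have h2 : ∫ p, p j * p k ∂ρ = ∫ p, (p j - p j ^ 2) ∂ρ := by
      refine integral_congr_ae (h1.mono fun p hp => ?_)
      rw [hpair] at hp
      simp only
      rw [show p k = 1 - p j by linarith]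
      ring
    rw [h2, integral_sub (hint j) hint2, hρ.integral_apply hα hsum htwo,
      hρ.integral_sq_apply hα hsum htwo]
    have : α k = a - α j := by linarith
    rw [this]
    field_simp
    ring

end Dirichlet

/-! ### Measurability and the Markov property of the exchange dynamics. -/

section Dynamics

@[fun_prop]
lemma measurable_exchangeStep :
    Measurable fun z : (ℤ → ℝ) × (ℤ → ℤ → ℝ) => exchangeStep z.1 z.2 := by
  refine measurable_pi_lambda _ fun j => Measurable.tsum fun i => ?_
  fun_prop

lemma massAt_succ_eq (τ : ℤ → ℝ) (p : ℕ → ℤ → ℤ → ℝ) (n : ℕ) :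
    massAt τ p (n + 1) = massAt (exchangeStep τ (p 0)) (fun k => p (k + 1)) n := by
  induction n with
  | zero => rfl
  | succ n ih => rw [massAt, ih]; rfl

@[fun_prop]
lemma measurable_massAt (n : ℕ) :
    Measurable fun z : (ℤ → ℝ) × (ℕ → ℤ → ℤ → ℝ) => massAt z.1 z.2 n := by
  induction n with
  | zero => exact measurable_fst
  | succ n ih =>
    have h : Measurable fun z : (ℤ → ℝ) × (ℕ → ℤ → ℤ → ℝ) => (massAt z.1 z.2 n, z.2 n) := by
      fun_prop
    exact measurable_exchangeStep.comp h

/-- The law of a sequence of independent rows with law `ρ`. -/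
noncomputable def rowsLaw (ρ : Measure (ℤ → ℝ)) : Measure (ℤ → ℤ → ℝ) :=
  Measure.infinitePi fun _ : ℤ => ρ

/-- The law of the configuration after one exchange step started with the law `ν`. -/
noncomputable def stepLaw (ρ ν : Measure (ℤ → ℝ)) : Measure (ℤ → ℝ) :=
  (ν.prod (rowsLaw ρ)).map fun z => exchangeStep z.1 z.2

instance (ρ : Measure (ℤ → ℝ)) [IsProbabilityMeasure ρ] : IsProbabilityMeasure (rowsLaw ρ) := by
  unfold rowsLaw; infer_instance

instance (ρ : Measure (ℤ → ℝ)) [IsProbabilityMeasure ρ] :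
    IsProbabilityMeasure (environmentLaw ρ) := by
  unfold environmentLaw; infer_instance

instance (ρ ν : Measure (ℤ → ℝ)) [IsProbabilityMeasure ρ] [IsProbabilityMeasure ν] :
    IsProbabilityMeasure (stepLaw ρ ν) :=
  Measure.isProbabilityMeasure_map measurable_exchangeStep.aemeasurable

/-- Put an element in front of a sequence. -/
def consSeq {X : Type*} (z : X × (ℕ → X)) : ℕ → X
  | 0 => z.1
  | n + 1 => z.2 n

lemma measurable_consSeq {X : Type*} [MeasurableSpace X] :
    Measurable (consSeq : X × (ℕ → X) → ℕ → X) := by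
  refine measurable_pi_lambda _ fun n => ?_
  cases n with
  | zero => exact measurable_fst
  | succ n => exact (measurable_pi_apply n).comp measurable_snd

lemma prod_infinitePi_map_consSeq {X : Type*} [MeasurableSpace X] (μ : Measure X)
    [IsProbabilityMeasure μ] :
    (μ.prod (Measure.infinitePi fun _ : ℕ => μ)).map consSeq =
      Measure.infinitePi fun _ : ℕ => μ := by
  classical
  refine Measure.eq_infinitePi _ fun s t ht => ?_
  obtain ⟨N, hN⟩ := s.exists_nat_subset_range
  -- Padding with the whole space turns `s` into an initial segment of `ℕ`, from which the factor at
  -- `0` can be split off.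
  let t' : ℕ → Set X := fun i => if i ∈ s then t i else Set.univ
  have ht' : ∀ i, MeasurableSet (t' i) := fun i => by
    simp only [t']
    split_ifs
    exacts [ht i, MeasurableSet.univ]
  have hset : (consSeq : X × (ℕ → X) → ℕ → X) ⁻¹' Set.pi (s : Set ℕ) t =
      t' 0 ×ˢ Set.pi (Finset.range N : Set ℕ) fun i => t' (i + 1) := by
    ext z
    simp only [Set.mem_preimage, Set.mem_pi, Set.mem_prod, Finset.mem_coe, Finset.mem_range, t']
    constructor
    · intro h
      refine ⟨?_, fun i _ => ?_⟩
      · split_ifs with h0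
        exacts [h 0 h0, Set.mem_univ _]
      · split_ifs with h0
        exacts [h (i + 1) h0, Set.mem_univ _]
    · rintro ⟨h0, h1⟩ i hi
      cases i with
      | zero => rw [if_pos hi] at h0; exact h0
      | succ i =>
        have hi' := Finset.mem_range.1 (hN hi)
        have h2 := h1 i (by omega)
        rw [if_pos hi] at h2
        exact h2
  have hprod : ∏ i ∈ s, μ (t i) = ∏ i ∈ Finset.range (N + 1), μ (t' i) := by
    have hs : s ⊆ Finset.range (N + 1) :=
      hN.trans (Finset.range_subset_range.2 (Nat.le_succ N))
    rw [← Finset.prod_subset hs (f := fun i => μ (t' i)) fun i _ hi => by simp [t', hi]]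
    exact Finset.prod_congr rfl fun i hi => by simp [t', hi]
  rw [Measure.map_apply measurable_consSeq (.pi s.countable_toSet fun i _ => ht i), hset,
    Measure.prod_prod, Measure.infinitePi_pi _ fun i _ => ht' _, hprod, Finset.prod_range_succ',
    mul_comm]

variable {ρ ν : Measure (ℤ → ℝ)}

/-- The Markov property: after one step, the configuration is independent of the remaining
environment, which has the original law. It permits inductions that peel off the first step and vary
the initial law. -/
lemma map_step_prodMk_shift [IsProbabilityMeasure ρ] [IsProbabilityMeasure ν] :
    (ν.prod (environmentLaw ρ)).map
        (fun z => (exchangeStep z.1 (z.2 0), fun n => z.2 (n + 1))) =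
      (stepLaw ρ ν).prod (environmentLaw ρ) := by
  have hcons : environmentLaw ρ = ((rowsLaw ρ).prod (environmentLaw ρ)).map consSeq :=
    (prod_infinitePi_map_consSeq _).symm
  have hS : Measurable fun z : (ℤ → ℝ) × (ℕ → ℤ → ℤ → ℝ) =>
      (exchangeStep z.1 (z.2 0), fun n => z.2 (n + 1)) := by
    refine Measurable.prodMk ?_ (by fun_prop)
    exact measurable_exchangeStep.comp
      (f := fun z : (ℤ → ℝ) × (ℕ → ℤ → ℤ → ℝ) => (z.1, z.2 0)) (by fun_prop)
  have h1 : ν.prod (environmentLaw ρ) =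
      (ν.prod ((rowsLaw ρ).prod (environmentLaw ρ))).map (Prod.map id consSeq) := by
    rw [← Measure.map_prod_map _ _ measurable_id measurable_consSeq, ← hcons, Measure.map_id]
  rw [h1, Measure.map_map hS (measurable_id.prodMap measurable_consSeq),
    ← Measure.prodAssoc_prod, Measure.map_map (hS.comp (measurable_id.prodMap measurable_consSeq))
      (MeasurableEquiv.measurable _), stepLaw]
  conv_rhs => rw [← Measure.map_id (μ := environmentLaw ρ)]
  rw [Measure.map_prod_map _ _ measurable_exchangeStep measurable_id]
  rfl

lemma massLaw_succ [IsProbabilityMeasure ρ] [IsProbabilityMeasure ν] (n : ℕ) :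
    massLaw ρ ν (n + 1) = massLaw ρ (stepLaw ρ ν) n := by
  have hS : Measurable fun z : (ℤ → ℝ) × (ℕ → ℤ → ℤ → ℝ) =>
      (exchangeStep z.1 (z.2 0), fun n => z.2 (n + 1)) := by
    refine Measurable.prodMk ?_ (by fun_prop)
    exact measurable_exchangeStep.comp
      (f := fun z : (ℤ → ℝ) × (ℕ → ℤ → ℤ → ℝ) => (z.1, z.2 0)) (by fun_prop)
  rw [massLaw, massLaw, ← map_step_prodMk_shift, Measure.map_map (measurable_massAt n) hS]
  congr 1
  ext z : 1
  exact massAt_succ_eq _ _ _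

lemma massLaw_zero [IsProbabilityMeasure ρ] [IsProbabilityMeasure ν] : massLaw ρ ν 0 = ν := by
  change (ν.prod (environmentLaw ρ)).map Prod.fst = ν
  rw [Measure.map_fst_prod, measure_univ, one_smul]

lemma massLaw_one [IsProbabilityMeasure ρ] [IsProbabilityMeasure ν] :
    massLaw ρ ν 1 = stepLaw ρ ν := by
  rw [massLaw_succ, massLaw_zero]

lemma massLaw_eq_of_stepLaw_eq [IsProbabilityMeasure ρ] [IsProbabilityMeasure ν]
    (h : stepLaw ρ ν = ν) (n : ℕ) : massLaw ρ ν n = ν := by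
  induction n with
  | zero => exact massLaw_zero
  | succ n ih => rw [massLaw_succ, h, ih]

end Dynamics

/-! ### The recursion for the mixed second moments. -/

section Covariance

lemma ae_summable_and_integrable_tsum {X ι : Type*} [Countable ι] [MeasurableSpace X]
    {μ : Measure X} {F : ι → X → ℝ} (hF : ∀ i, Integrable (F i) μ)
    (hs : Summable fun i => ∫ x, ‖F i x‖ ∂μ) :
    (∀ᵐ x ∂μ, Summable fun i => ‖F i x‖) ∧ Integrable (fun x => ∑' i, F i x) μ := by
  have htop : ∑' i, ∫⁻ x, ‖F i x‖ₑ ∂μ ≠ ∞ := by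
    simp_rw [fun i => (ofReal_integral_norm_eq_lintegral_enorm (hF i)).symm]
    exact hs.tsum_ofReal_ne_top
  refine ⟨summable_norm_of_tsum_eLpNorm_ne_top le_rfl (fun i => (hF i).1) ?_, ?_⟩
  · simpa only [eLpNorm_one_eq_lintegral_enorm] using htop
  · refine ⟨(AEMeasurable.tsum fun i => (hF i).aemeasurable).aestronglyMeasurable, ?_⟩
    calc ∫⁻ x, ‖∑' i, F i x‖ₑ ∂μ ≤ ∫⁻ x, ∑' i, ‖F i x‖ₑ ∂μ :=
          lintegral_mono fun x => enorm_tsum_le_tsum_enorm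
      _ = ∑' i, ∫⁻ x, ‖F i x‖ₑ ∂μ := lintegral_tsum fun i => (hF i).1.enorm
      _ < ∞ := htop.lt_top

/-- The law of the difference of two independent variables with law `e`. -/
noncomputable def differenceLaw (e : ℤ → ℝ) (z : ℤ) : ℝ := ∑' u, e (-u) * e (z - u)

section Difference

lemma differenceLaw_nonneg {e : ℤ → ℝ} (he0 : ∀ i, 0 ≤ e i) (z : ℤ) : 0 ≤ differenceLaw e z :=
  tsum_nonneg fun _ => mul_nonneg (he0 _) (he0 _)

lemma hasSum_neg_comp {e : ℤ → ℝ} (he : HasSum e 1) : HasSum (fun u => e (-u)) 1 :=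
  (Equiv.neg ℤ).hasSum_iff.2 he

variable {e : ℤ → ℝ} (he0 : ∀ i, 0 ≤ e i) (he : HasSum e 1)
include he0 he

lemma hasSum_differenceLaw : HasSum (differenceLaw e) 1 := by
  have h := hasSum_convolution (fun u => he0 (-u)) (hasSum_neg_comp he) he0 he
  rw [one_mul] at h
  exact h

lemma summable_differenceLaw_terms (z : ℤ) : Summable fun u => e (-u) * e (z - u) :=
  summable_convolution (fun u => he0 (-u)) (hasSum_neg_comp he).summable he0 he.summable z

lemma differenceLaw_sub_pos {i j : ℤ} (hi : 0 < e i) (hj : 0 < e j) :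
    0 < differenceLaw e (j - i) := by
  refine (summable_differenceLaw_terms he0 he _).tsum_pos
    (fun u => mul_nonneg (he0 _) (he0 _)) (-i) ?_
  rw [neg_neg, sub_neg_eq_add, sub_add_cancel]
  exact mul_pos hi hj

/-- The product terms give the convolution of `r` with the difference law. The diagonal correction,
due to the dependence within one row, moves the fraction `κ` of the mass at the origin from its
convolution back to the origin. Only boundedness of `r` is needed, so constants are allowed as
dominating functions. -/
lemma hasSum_covariance_terms {r : ℤ → ℝ} {C : ℝ} (hr : ∀ z, |r z| ≤ C) (κ : ℝ) (j k : ℤ) :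
    HasSum (fun x : ℤ × ℤ => r (x.2 - x.1) * (e (j - x.1) * e (k - x.2) +
      if x.1 = x.2 then κ * ((if j = k then e (j - x.1) else 0) - e (j - x.1) * e (k - x.1))
        else 0)) (pairStep (differenceLaw e) κ r (k - j)) := by
  have hd := hasSum_differenceLaw he0 he
  have hdr : Summable fun z => differenceLaw e z * r (k - j - z) := by
    refine Summable.of_norm_bounded (hd.summable.mul_right C) fun z => ?_
    rw [norm_mul, Real.norm_of_nonneg (differenceLaw_nonneg he0 z)]
    exact mul_le_mul_of_nonneg_left (hr _) (differenceLaw_nonneg he0 z)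
  have hstep : pairStep (differenceLaw e) κ r (k - j) =
      ∑' z, differenceLaw e z * r (k - j - z) +
        r 0 * κ * ((if j = k then 1 else 0) - differenceLaw e (k - j)) := by
    have h1 : HasSum (fun z => differenceLaw e z * moverPart κ r (k - j - z))
        (∑' z, differenceLaw e z * r (k - j - z) - differenceLaw e (k - j) * (κ * r 0)) := by
      have := hdr.hasSum.sub
        (hasSum_ite_eq (k - j) (differenceLaw e (k - j) * (κ * r 0)))
      convert! this using 1
      ext z
      unfold moverPart
      by_cases hz : z = k - j
      · rw [if_pos hz, hz, sub_self, if_pos rfl]; ring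
      · rw [if_neg hz, if_neg (fun h => hz (sub_eq_zero.1 h).symm), sub_zero]
    rw [pairStep, h1.tsum_eq]
    by_cases hjk : j = k
    · rw [if_pos (sub_eq_zero.2 hjk.symm), if_pos hjk]; ring
    · rw [if_neg (fun h => hjk (sub_eq_zero.1 h).symm), if_neg hjk]; ring
  have hoff : HasSum (fun x : ℤ × ℤ => r (x.2 - x.1) * (e (j - x.1) * e (k - x.2)))
      (∑' z, differenceLaw e z * r (k - j - z)) := by
    -- In the new coordinates `(z, u)` the factor from `r` depends on `z` alone, and the sum over
    -- `u` is `differenceLaw e z`.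
    let E : ℤ × ℤ ≃ ℤ × ℤ :=
      { toFun := fun x => (j + x.2, k - x.1 + x.2)
        invFun := fun x => (k - x.2 + (x.1 - j), x.1 - j)
        left_inv := fun x => by ext <;> simp only <;> ring
        right_inv := fun x => by ext <;> simp only <;> ring }
    rw [← E.hasSum_iff]
    have hs : Summable fun x : ℤ × ℤ => e (-x.2) * e (x.1 - x.2) :=
      (Equiv.prodComm ℤ ℤ).summable_iff.2 (summable_mul_comp_sub (fun u => he0 (-u))
        (hasSum_neg_comp he).summable he0 he.summable)
    have hterm : ∀ x : ℤ × ℤ, ((fun x : ℤ × ℤ => r (x.2 - x.1) * (e (j - x.1) * e (k - x.2))) ∘ E) x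
        = r (k - j - x.1) * (e (-x.2) * e (x.1 - x.2)) := by
      intro x
      simp only [Function.comp, E, Equiv.coe_fn_mk]
      congr 2 <;> ring_nf
    have hsum : Summable fun x : ℤ × ℤ => r (k - j - x.1) * (e (-x.2) * e (x.1 - x.2)) := by
      refine Summable.of_norm_bounded (hs.mul_left C) fun x => ?_
      have h0 := mul_nonneg (he0 (-x.2)) (he0 (x.1 - x.2))
      rw [norm_mul, Real.norm_of_nonneg h0]
      exact mul_le_mul_of_nonneg_right (hr _) h0
    rw [funext hterm]
    have h2 : ∑' x : ℤ × ℤ, r (k - j - x.1) * (e (-x.2) * e (x.1 - x.2)) =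
        ∑' z, differenceLaw e z * r (k - j - z) := by
      rw [hsum.tsum_prod]
      refine tsum_congr fun z => ?_
      dsimp only
      rw [tsum_mul_left, mul_comm, differenceLaw]
    rw [← h2]
    exact hsum.hasSum
  have hdiag : HasSum (fun x : ℤ × ℤ => r (x.2 - x.1) * (if x.1 = x.2 then
      κ * ((if j = k then e (j - x.1) else 0) - e (j - x.1) * e (k - x.1)) else 0))
      (r 0 * κ * ((if j = k then 1 else 0) - differenceLaw e (k - j))) := by
    have hinj : Function.Injective fun i : ℤ => (i, i) := fun i j h => (Prod.ext_iff.1 h).1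
    rw [← hinj.hasSum_iff]
    · have h1 : HasSum (fun i : ℤ => e (j - i)) 1 := (Equiv.subLeft j).hasSum_iff.2 he
      have h2 : HasSum (fun i : ℤ => if j = k then e (j - i) else 0) (if j = k then 1 else 0) := by
        split_ifs
        · exact h1
        · exact hasSum_zero
      have h3 : HasSum (fun i : ℤ => e (j - i) * e (k - i)) (differenceLaw e (k - j)) := by
        rw [← (Equiv.addLeft j).hasSum_iff]
        have := (summable_differenceLaw_terms he0 he (k - j)).hasSum
        convert! this using 1
        ext u
        simp only [Function.comp, Equiv.coe_addLeft]
        congr 2 <;> ring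
      have h4 := (h2.sub h3).mul_left (r 0 * κ)
      convert! h4 using 1
      ext i
      simp only [Function.comp, sub_self, if_true]
      ring
    · rintro ⟨x, y⟩ hx
      have hxy : x ≠ y := fun h => hx ⟨x, by rw [h]⟩
      simp [hxy]
  rw [hstep]
  convert! hoff.add hdiag using 1
  ext x
  ring

end Difference

/-- Under `ν`, the coordinates are square integrable and the second mixed moment of the coordinates
`j` and `k` is `r (k - j)`. -/
structure HasMixedMoments (ν : Measure (ℤ → ℝ)) (r : ℤ → ℝ) : Prop where
  memLp : ∀ j, MemLp (fun x : ℤ → ℝ => x j) 2 ν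
  integral_mul : ∀ j k, ∫ x, x j * x k ∂ν = r (k - j)

lemma HasMixedMoments.integrable_mul {ν : Measure (ℤ → ℝ)} {r : ℤ → ℝ} (h : HasMixedMoments ν r)
    (j k : ℤ) : Integrable (fun x : ℤ → ℝ => x j * x k) ν := (h.memLp j).integrable_mul (h.memLp k)

lemma HasMixedMoments.integral_abs_mul_le {ν : Measure (ℤ → ℝ)} {r : ℤ → ℝ}
    (h : HasMixedMoments ν r) (j k : ℤ) : ∫ x, ‖x j * x k‖ ∂ν ≤ r 0 := by
  have hj := h.integral_mul j j
  have hk := h.integral_mul k k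
  rw [sub_self] at hj hk
  have h1 : ∫ x, (x j * x j / 2 + x k * x k / 2) ∂ν = r 0 := by
    rw [integral_add ((h.integrable_mul j j).div_const 2) ((h.integrable_mul k k).div_const 2),
      integral_div, integral_div, hj, hk, add_halves]
  rw [← h1]
  refine integral_mono (h.integrable_mul j k).norm
    (((h.integrable_mul j j).div_const 2).add ((h.integrable_mul k k).div_const 2)) fun x => ?_
  simp only [norm_mul, Real.norm_eq_abs]
  nlinarith [sq_nonneg (|x j| - |x k|), abs_mul_abs_self (x j), abs_mul_abs_self (x k)]

lemma HasMixedMoments.abs_le {ν : Measure (ℤ → ℝ)} {r : ℤ → ℝ}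
    (h : HasMixedMoments ν r) (z : ℤ) : |r z| ≤ r 0 := by
  have h1 := h.integral_mul 0 z
  rw [sub_zero] at h1
  rw [← h1, ← Real.norm_eq_abs]
  exact (norm_integral_le_integral_norm _).trans (h.integral_abs_mul_le 0 z)

variable {α : ℤ → ℝ} {a : ℝ} {ρ ν : Measure (ℤ → ℝ)} {r : ℤ → ℝ}

lemma IsDirichlet.ae_mem_Icc (hρ : IsDirichlet α ρ) (i : ℤ) : ∀ᵐ p ∂ρ, 0 ≤ p i ∧ p i ≤ 1 := by
  filter_upwards [hρ.nonneg, hρ.hasSum_one] with p hp hs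
  exact ⟨hp i, le_hasSum hs i fun j _ => hp j⟩

lemma IsDirichlet.ae_rows_mem_Icc (hρ : IsDirichlet α ρ) (i k : ℤ) :
    ∀ᵐ P ∂rowsLaw ρ, 0 ≤ P i k ∧ P i k ≤ 1 := by
  have := hρ.isProbabilityMeasure
  exact (measurePreserving_eval_infinitePi (fun _ : ℤ => ρ) i).quasiMeasurePreserving.ae
    (hρ.ae_mem_Icc k)

lemma integral_rowsLaw_eval [IsProbabilityMeasure ρ] (i : ℤ) {f : (ℤ → ℝ) → ℝ}
    (hf : Measurable f) : ∫ P, f (P i) ∂rowsLaw ρ = ∫ p, f p ∂ρ := by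
  conv_rhs => rw [← (measurePreserving_eval_infinitePi (fun _ : ℤ => ρ) i).map_eq]
  rw [integral_map (measurable_pi_apply i).aemeasurable hf.aestronglyMeasurable]
  rfl

lemma IsDirichlet.integrable_rows_mul (hρ : IsDirichlet α ρ) (i k i' k' : ℤ) :
    Integrable (fun P : ℤ → ℤ → ℝ => P i k * P i' k') (rowsLaw ρ) := by
  have := hρ.isProbabilityMeasure
  refine Integrable.of_bound (Measurable.aestronglyMeasurable (by fun_prop)) 1 ?_
  filter_upwards [hρ.ae_rows_mem_Icc i k, hρ.ae_rows_mem_Icc i' k'] with P h1 h2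
  rw [Real.norm_of_nonneg (mul_nonneg h1.1 h2.1)]
  exact mul_le_one₀ h1.2 h2.1 h2.2

section

variable (hα : ∀ i, 0 ≤ α i) (hsum : HasSum α a) (htwo : ∃ i j, i ≠ j ∧ 0 < α i ∧ 0 < α j)
include hα hsum htwo

/-- Rows of different agents are independent, so only the product of means remains. Within one row
the Dirichlet covariance is `1 / (a + 1)` times the covariance of a single draw from the law `α /
a`. -/
lemma IsDirichlet.integral_rows_mul (hρ : IsDirichlet α ρ) (j k i i' : ℤ) :
    ∫ P, P i (j - i) * P i' (k - i') ∂rowsLaw ρ =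
      α (j - i) / a * (α (k - i') / a) + if i = i' then 1 / (a + 1) *
        ((if j = k then α (j - i) / a else 0) - α (j - i) / a * (α (k - i) / a)) else 0 := by
  have := hρ.isProbabilityMeasure
  have ha := total_pos hα hsum htwo
  have heval (i k : ℤ) : ∫ P, P i k ∂rowsLaw ρ = α k / a := by
    rw [integral_rowsLaw_eval i (measurable_pi_apply k), hρ.integral_apply hα hsum htwo k]
  by_cases hi : i = i'
  · subst hi
    rw [if_pos rfl]
    have hmap : ∫ P, P i (j - i) * P i (k - i) ∂rowsLaw ρ = ∫ p, p (j - i) * p (k - i) ∂ρ :=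
      integral_rowsLaw_eval i (f := fun p => p (j - i) * p (k - i)) (by fun_prop)
    rw [hmap]
    by_cases hjk : j = k
    · subst hjk
      rw [if_pos rfl]
      have h := hρ.integral_sq_apply hα hsum htwo (j - i)
      simp only [sq] at h
      rw [h]
      field_simp
      ring
    · rw [if_neg hjk, hρ.integral_mul_apply hα hsum htwo (fun h => hjk (by linarith))]
      field_simp
      ring
  · rw [if_neg hi, add_zero]
    have hind := (iIndepFun_infinitePi (P := fun _ : ℤ => ρ) (X := fun _ x => x)
      fun _ => measurable_id).indepFun hi
    have h := (hind.comp (measurable_pi_apply (j - i))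
      (measurable_pi_apply (k - i'))).integral_fun_mul_eq_mul_integral
      (Measurable.aestronglyMeasurable (by fun_prop))
      (Measurable.aestronglyMeasurable (by fun_prop))
    rw [← heval i, ← heval i']
    exact h

/-- One exchange step acts on the mixed moments by `pairStep`. -/
theorem HasMixedMoments.step (hρ : IsDirichlet α ρ) [IsProbabilityMeasure ν]
    (h : HasMixedMoments ν r) :
    (∀ᵐ z ∂ν.prod (rowsLaw ρ), ∀ j, Summable fun i => ‖z.1 i * z.2 i (j - i)‖) ∧
    HasMixedMoments (stepLaw ρ ν)
      (pairStep (differenceLaw fun i => α i / a) (1 / (a + 1)) r) := by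
  have := hρ.isProbabilityMeasure
  have ha := total_pos hα hsum htwo
  have he0 : ∀ i, 0 ≤ α i / a := fun i => div_nonneg (hα i) ha.le
  have he : HasSum (fun i => α i / a) 1 := by
    simpa only [div_self ha.ne'] using hsum.div_const a
  let F (j k : ℤ) (x : ℤ × ℤ) (z : (ℤ → ℝ) × (ℤ → ℤ → ℝ)) : ℝ :=
    (z.1 x.1 * z.1 x.2) * (z.2 x.1 (j - x.1) * z.2 x.2 (k - x.2))
  have hFint (j k : ℤ) (x : ℤ × ℤ) : Integrable (F j k x) (ν.prod (rowsLaw ρ)) :=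
    (h.integrable_mul x.1 x.2).mul_prod (hρ.integrable_rows_mul _ _ _ _)
  have hFnorm (j k : ℤ) : Summable fun x => ∫ z, ‖F j k x z‖ ∂(ν.prod (rowsLaw ρ)) := by
    -- The absolute mixed moments of the masses are at most `r 0`, so the same double sum with the
    -- constant `r 0` dominates.
    have h1 := (hasSum_covariance_terms he0 he (r := fun _ => r 0) (C := |r 0|) (fun _ => le_rfl)
      (1 / (a + 1)) j k).summable
    refine Summable.of_nonneg_of_le (fun x => integral_nonneg fun z => norm_nonneg _)
      (fun x => ?_) h1
    rw [← hρ.integral_rows_mul hα hsum htwo]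
    have h2 : ∫ P, ‖P x.1 (j - x.1) * P x.2 (k - x.2)‖ ∂rowsLaw ρ =
        ∫ P, P x.1 (j - x.1) * P x.2 (k - x.2) ∂rowsLaw ρ := by
      refine integral_congr_ae ?_
      filter_upwards [hρ.ae_rows_mem_Icc x.1 (j - x.1), hρ.ae_rows_mem_Icc x.2 (k - x.2)]
        with P h1 h2
      exact Real.norm_of_nonneg (mul_nonneg h1.1 h2.1)
    have h3 : 0 ≤ ∫ P, P x.1 (j - x.1) * P x.2 (k - x.2) ∂rowsLaw ρ := by
      rw [← h2]
      exact integral_nonneg fun z => norm_nonneg _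
    have h4 : ∫ z, ‖F j k x z‖ ∂(ν.prod (rowsLaw ρ)) = (∫ y, ‖y x.1 * y x.2‖ ∂ν) *
        ∫ P, ‖P x.1 (j - x.1) * P x.2 (k - x.2)‖ ∂rowsLaw ρ := by
      rw [← integral_prod_mul]
      exact integral_congr_ae (ae_of_all _ fun z => norm_mul _ _)
    rw [h4, h2]
    exact mul_le_mul_of_nonneg_right (h.integral_abs_mul_le _ _) h3
  have hsummable : ∀ᵐ z ∂ν.prod (rowsLaw ρ), ∀ j, Summable fun i => ‖z.1 i * z.2 i (j - i)‖ := by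
    have hrows : ∀ᵐ z ∂ν.prod (rowsLaw ρ), ∀ i k, 0 ≤ z.2 i k := by
      refine Measure.quasiMeasurePreserving_snd.ae (p := fun P : ℤ → ℤ → ℝ => ∀ i k, 0 ≤ P i k) ?_
      exact ae_all_iff.2 fun i => ae_all_iff.2 fun k => (hρ.ae_rows_mem_Icc i k).mono
        fun P h => h.1
    have hone (j : ℤ) : ∀ᵐ z ∂ν.prod (rowsLaw ρ), Summable fun i => ‖z.1 i * z.2 i (j - i)‖ := by
      refine (ae_summable_and_integrable_tsum
        (F := fun i (z : (ℤ → ℝ) × (ℤ → ℤ → ℝ)) => z.1 i * z.2 i (j - i)) (fun i => ?_) ?_).1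
      · refine ((h.memLp i).integrable (by norm_num)).mul_prod (g := fun P : ℤ → ℤ → ℝ => P i (j - i)) ?_
        refine Integrable.of_bound (Measurable.aestronglyMeasurable (by fun_prop)) 1 ?_
        filter_upwards [hρ.ae_rows_mem_Icc i (j - i)] with P hP
        rw [Real.norm_of_nonneg hP.1]
        exact hP.2
      -- The constant `1 + r 0` bounds the first absolute moment, by `|y| ≤ 1 + y ^ 2`.
      · have hmeas : Summable fun i => (1 + r 0) * (α (j - i) / a) :=
          ((Equiv.subLeft j).summable_iff.2 he.summable).mul_left (1 + r 0)
        refine Summable.of_nonneg_of_le (fun i => integral_nonneg fun z => norm_nonneg _)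
          (fun i => ?_) hmeas
        have h4 : ∫ z, ‖z.1 i * z.2 i (j - i)‖ ∂(ν.prod (rowsLaw ρ)) = (∫ y, ‖y i‖ ∂ν) *
            ∫ P, ‖P i (j - i)‖ ∂rowsLaw ρ := by
          rw [← integral_prod_mul]
          exact integral_congr_ae (ae_of_all _ fun z => norm_mul _ _)
        have h5 : ∫ P, ‖P i (j - i)‖ ∂rowsLaw ρ = α (j - i) / a := by
          rw [← hρ.integral_apply hα hsum htwo (j - i),
            ← integral_rowsLaw_eval i (measurable_pi_apply (j - i))]
          refine integral_congr_ae ?_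
          filter_upwards [hρ.ae_rows_mem_Icc i (j - i)] with P hP
          exact Real.norm_of_nonneg hP.1
        rw [h4, h5]
        refine mul_le_mul_of_nonneg_right ?_ (he0 _)
        have h7 := h.integral_mul i i
        rw [sub_self] at h7
        have h8 : ∫ y, (1 + y i * y i) ∂ν = 1 + r 0 := by
          rw [integral_add (integrable_const _) (h.integrable_mul i i), h7]
          simp
        rw [← h8]
        refine integral_mono ((h.memLp i).integrable (by norm_num)).norm
          ((integrable_const _).add (h.integrable_mul i i)) fun y => ?_
        simp only [Real.norm_eq_abs]
        nlinarith [abs_mul_abs_self (y i), sq_nonneg (|y i| - 1)]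
    exact ae_all_iff.2 hone
  have hprod (j k : ℤ) : ∀ᵐ z ∂ν.prod (rowsLaw ρ),
      ∑' x, F j k x z = exchangeStep z.1 z.2 j * exchangeStep z.1 z.2 k := by
    filter_upwards [hsummable] with z hz
    rw [exchangeStep, exchangeStep, tsum_mul_tsum_of_summable_norm (hz j) (hz k)]
    refine tsum_congr fun x => ?_
    simp only [F]
    ring
  have hint (j k : ℤ) : Integrable (fun z => exchangeStep z.1 z.2 j * exchangeStep z.1 z.2 k)
      (ν.prod (rowsLaw ρ)) :=
    (ae_summable_and_integrable_tsum (hFint j k) (hFnorm j k)).2.congr (hprod j k)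
  have hcoord (j : ℤ) : Measurable fun z : (ℤ → ℝ) × (ℤ → ℤ → ℝ) => exchangeStep z.1 z.2 j :=
    (measurable_pi_apply j).comp measurable_exchangeStep
  refine ⟨hsummable, fun j => ?_, fun j k => ?_⟩
  · rw [stepLaw, memLp_map_measure_iff (measurable_pi_apply j).aestronglyMeasurable
      measurable_exchangeStep.aemeasurable]
    refine (memLp_two_iff_integrable_sq (hcoord j).aestronglyMeasurable).2 ?_
    simpa only [sq] using hint j j
  · rw [stepLaw, integral_map measurable_exchangeStep.aemeasurable
      (Measurable.aestronglyMeasurable (by fun_prop)), ← integral_congr_ae (hprod j k)]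
    refine (hasSum_integral_of_summable_integral_norm (hFint j k) (hFnorm j k)).unique ?_
    have h1 := hasSum_covariance_terms he0 he h.abs_le (1 / (a + 1)) j k
    convert! h1 using 1
    ext x
    rw [← hρ.integral_rows_mul hα hsum htwo, ← h.integral_mul x.1 x.2, ← integral_prod_mul]

end

end Covariance

/-! ### Independent sequences: characterisation and moments. -/

section IndependentSequences

lemma integral_prod_infinitePi {ι X : Type*} [MeasurableSpace X] (μ : Measure X)
    [IsProbabilityMeasure μ] (S : Finset ι) {f : ι → X → ℂ} (hf : ∀ i, Measurable (f i)) :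
    ∫ x, ∏ i ∈ S, f i (x i) ∂(Measure.infinitePi fun _ : ι => μ) = ∏ i ∈ S, ∫ x, f i x ∂μ := by
  have h := integral_restrict_infinitePi (μ := fun _ : ι => μ) (s := S)
    (f := fun y => ∏ i : S, f i (y i)) (Measurable.aestronglyMeasurable
      (Finset.measurable_fun_prod _ fun i _ => (hf i).comp (measurable_pi_apply i)))
  rw [integral_fintype_prod_eq_prod (𝕜 := ℂ) (f := fun (i : S) (x : X) => f i x)] at h
  rw [← Finset.prod_coe_sort S fun i => ∫ x, f i x ∂μ, ← h]
  congr 1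
  ext x
  rw [← Finset.prod_coe_sort]
  rfl

/-- The law of a sequence is determined by its finite-dimensional marginals, and these by their
characteristic functions; a linear functional on `I → ℝ` is given by its values on the unit vectors.
-/
lemma infinitePi_eq_of_integral_cexp {μ : Measure ℝ} [IsProbabilityMeasure μ]
    {ν : Measure (ℤ → ℝ)} [IsProbabilityMeasure ν]
    (h : ∀ (I : Finset ℤ) (t : ℤ → ℝ),
      ∫ x, Complex.exp ((∑ j ∈ I, t j * x j : ℝ) * Complex.I) ∂ν = ∏ j ∈ I, charFun μ (t j)) :
    ν = Measure.infinitePi fun _ : ℤ => μ := by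
  classical
  refine IsProjectiveLimit.unique (P := fun I : Finset ℤ => Measure.pi fun _ : I => μ)
    (fun I => ?_) (Measure.isProjectiveLimit_infinitePi fun _ : ℤ => μ)
  have : IsProbabilityMeasure (ν.map I.restrict) :=
    Measure.isProbabilityMeasure_map (by fun_prop)
  refine Measure.ext_of_charFunDual (funext fun L => ?_)
  let t : ℤ → ℝ := fun j => if hj : j ∈ I then L (Pi.single ⟨j, hj⟩ 1) else 0
  have hL (v : I → ℝ) : L v = ∑ j : I, t j * v j := by
    conv_lhs => rw [← Finset.univ_sum_single v, map_sum]
    refine Finset.sum_congr rfl fun j _ => ?_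
    have : (Pi.single j (v j) : I → ℝ) = v j • Pi.single j 1 := by
      rw [← Pi.single_smul, smul_eq_mul, mul_one]
    rw [this, map_smul, smul_eq_mul, mul_comm]
    simp [t]
  have h1 := h I t
  rw [charFunDual_apply, charFunDual_apply, integral_map (by fun_prop) (by fun_prop)]
  have h2 : ∀ x : ℤ → ℝ, L (I.restrict x) = ∑ j ∈ I, t j * x j := fun x => by
    rw [hL, ← Finset.sum_coe_sort I]
    rfl
  simp_rw [h2]
  rw [h1]
  simp_rw [hL, charFun_apply_real]
  rw [← Finset.prod_coe_sort I, ← integral_fintype_prod_eq_prod (𝕜 := ℂ)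
    (f := fun (j : I) (x : ℝ) => Complex.exp (t j * x * Complex.I))]
  congr 1
  ext v
  rw [← Complex.exp_sum]
  push_cast
  rw [Finset.sum_mul]

/-- The first two moments of a sequence of independent variables with law `F`. -/
lemma hasMixedMoments_infinitePi {F : Measure ℝ} [IsProbabilityMeasure F]
    (hF : MemLp (fun x : ℝ => x) 2 F) :
    HasMixedMoments (Measure.infinitePi fun _ : ℤ => F)
      fun z => if z = 0 then ∫ x, x ^ 2 ∂F else (∫ x, x ∂F) ^ 2 := by
  have hmp (i : ℤ) := measurePreserving_eval_infinitePi (fun _ : ℤ => F) i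
  have hmean (i : ℤ) : ∫ x, x i ∂(Measure.infinitePi fun _ : ℤ => F) = ∫ x, x ∂F := by
    conv_rhs => rw [← (hmp i).map_eq]
    rw [integral_map (hmp i).measurable.aemeasurable (by fun_prop)]
  refine ⟨fun j => hF.comp_measurePreserving (hmp j), fun j k => ?_⟩
  by_cases hjk : j = k
  · subst hjk
    rw [if_pos (sub_self j)]
    conv_rhs => rw [← (hmp j).map_eq]
    rw [integral_map (measurable_pi_apply j).aemeasurable (by fun_prop)]
    simp only [sq]
  · rw [if_neg (fun h => hjk (sub_eq_zero.1 h).symm)]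
    have hind := (iIndepFun_infinitePi (P := fun _ : ℤ => F) (X := fun _ x => x)
      fun _ => measurable_id).indepFun hjk
    have h := hind.integral_fun_mul_eq_mul_integral
      (Measurable.aestronglyMeasurable (by fun_prop))
      (Measurable.aestronglyMeasurable (by fun_prop))
    rw [h, hmean, hmean, sq]

end IndependentSequences

/-! ### Invariance of independent Gamma masses. -/

section Invariance

variable {α : ℤ → ℝ} {a γ : ℝ} {ρ : Measure (ℤ → ℝ)}

/-- Only the donors in the finite set `S` are taken into account. The integral factorises over
donors, each factor is given by the Gamma–Dirichlet identity, and for each recipient `j` the shapes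
add up. -/
lemma IsDirichlet.integral_cexp_partial (hρ : IsDirichlet α ρ) (hα : ∀ i, 0 ≤ α i)
    (hsum : HasSum α a) (ha : 0 < a) (hγ : 0 < γ) (I S : Finset ℤ) (t : ℤ → ℝ) :
    ∫ z, Complex.exp ((∑ i ∈ S, z.1 i * ∑ j ∈ I, t j * z.2 i (j - i) : ℝ) * Complex.I)
        ∂((gammaSequence a γ).prod (rowsLaw ρ)) =
      ∏ j ∈ I, gammaChar γ (∑ i ∈ S, α (j - i)) (t j) := by
  have := hρ.isProbabilityMeasure
  have := isProbabilityMeasure_gammaMeasure ha hγ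
  have hgs : IsProbabilityMeasure (gammaSequence a γ) := by unfold gammaSequence; infer_instance
  let f (i : ℤ) (x : ℝ) (p : ℤ → ℝ) : ℂ :=
    Complex.exp ((x * ∑ j ∈ I, t j * p (j - i) : ℝ) * Complex.I)
  have hf (i : ℤ) : Measurable (Function.uncurry (f i)) := by
    simp only [Function.uncurry_def, f]; fun_prop
  have hbound (i : ℤ) (z : ℝ × (ℤ → ℝ)) : ‖Function.uncurry (f i) z‖ ≤ 1 :=
    (Complex.norm_exp_ofReal_mul_I _).le
  have hone (i : ℤ) : ∫ x, ∫ p, f i x p ∂ρ ∂(gammaMeasure a γ) =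
      ∏ j ∈ I, gammaChar γ (α (j - i)) (t j) := by
    refine (integral_prod (Function.uncurry (f i))
      (Integrable.of_bound (hf i).aestronglyMeasurable 1 (ae_of_all _ (hbound i)))).symm.trans ?_
    have h := hρ.integral_cexp hα hsum ha hγ (I.map (Equiv.subRight i).toEmbedding)
      (fun k => t (k + i))
    simp only [Finset.sum_map, Finset.prod_map, Equiv.coe_toEmbedding, Equiv.subRight_apply,
      sub_add_cancel] at h
    rw [← h]
    congr 1
    ext z
    simp only [Function.uncurry_def, f, Finset.mul_sum]
    congr 3
    refine Finset.sum_congr rfl fun j _ => by ring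
  have hprod : ∀ z : (ℤ → ℝ) × (ℤ → ℤ → ℝ),
      Complex.exp ((∑ i ∈ S, z.1 i * ∑ j ∈ I, t j * z.2 i (j - i) : ℝ) * Complex.I) =
        ∏ i ∈ S, f i (z.1 i) (z.2 i) := by
    intro z
    rw [← Complex.exp_sum, ← Finset.sum_mul]
    push_cast
    rfl
  simp_rw [hprod]
  rw [integral_prod (fun z : (ℤ → ℝ) × (ℤ → ℤ → ℝ) => ∏ i ∈ S, f i (z.1 i) (z.2 i))]
  · have hinner (x : ℤ → ℝ) : ∫ P, ∏ i ∈ S, f i (x i) (P i) ∂rowsLaw ρ =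
        ∏ i ∈ S, ∫ p, f i (x i) p ∂ρ :=
      integral_prod_infinitePi ρ S (f := fun i p => f i (x i) p)
        fun i => (hf i).comp measurable_prodMk_left
    simp_rw [hinner]
    rw [gammaSequence, integral_prod_infinitePi (gammaMeasure a γ) S
      (f := fun i x => ∫ p, f i x p ∂ρ)
      fun i => (hf i).stronglyMeasurable.integral_prod_right.measurable]
    simp_rw [hone]
    rw [Finset.prod_comm]
    exact Finset.prod_congr rfl fun j _ => gammaChar_sum S (fun i => α (j - i)) (t j)
  · refine Integrable.of_bound (Measurable.aestronglyMeasurable ?_) 1 (ae_of_all _ fun z => ?_)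
    · refine Finset.measurable_fun_prod _ fun i _ => ?_
      exact (hf i).comp (g := Function.uncurry (f i))
        (f := fun z : (ℤ → ℝ) × (ℤ → ℤ → ℝ) => (z.1 i, z.2 i)) (by fun_prop)
    · rw [norm_prod]
      exact Finset.prod_le_one (fun i _ => norm_nonneg _) fun i _ => hbound i (z.1 i, z.2 i)

/-- Independent Gamma variables are invariant under an exchange step with Dirichlet rows. -/
theorem stepLaw_gammaSequence (hα : ∀ i, 0 ≤ α i) (hsum : HasSum α a)
    (htwo : ∃ i j, i ≠ j ∧ 0 < α i ∧ 0 < α j) (hρ : IsDirichlet α ρ) (hγ : 0 < γ) :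
    stepLaw ρ (gammaSequence a γ) = gammaSequence a γ := by
  have ha := total_pos hα hsum htwo
  have := hρ.isProbabilityMeasure
  have := isProbabilityMeasure_gammaMeasure ha hγ
  have hgs : IsProbabilityMeasure (gammaSequence a γ) := by unfold gammaSequence; infer_instance
  refine infinitePi_eq_of_integral_cexp fun I t => ?_
  have hsummable := ((hasMixedMoments_infinitePi (memLp_two_gammaMeasure ha hγ)).step
    hα hsum htwo hρ).1
  rw [stepLaw, integral_map measurable_exchangeStep.aemeasurable
    (Measurable.aestronglyMeasurable (by fun_prop))]
  -- Dominated convergence along finite sets of donors; the integrands have modulus at most one.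
  have hlim : Tendsto (fun S : Finset ℤ => ∫ z, Complex.exp
      ((∑ i ∈ S, z.1 i * ∑ j ∈ I, t j * z.2 i (j - i) : ℝ) * Complex.I)
        ∂((gammaSequence a γ).prod (rowsLaw ρ))) atTop
      (𝓝 (∫ z, Complex.exp ((∑ j ∈ I, t j * exchangeStep z.1 z.2 j : ℝ) * Complex.I)
        ∂((gammaSequence a γ).prod (rowsLaw ρ)))) := by
    refine tendsto_integral_filter_of_norm_le_const (Eventually.of_forall fun S => ?_)
      ⟨1, Eventually.of_forall fun S => ae_of_all _ fun z =>
        (Complex.norm_exp_ofReal_mul_I _).le⟩ ?_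
    · exact Measurable.aestronglyMeasurable (by fun_prop)
    · refine hsummable.mono fun z hz => ?_
      have h1 : HasSum (fun i => z.1 i * ∑ j ∈ I, t j * z.2 i (j - i))
          (∑ j ∈ I, t j * exchangeStep z.1 z.2 j) := by
        have h2 := hasSum_sum (s := I) fun j _ => ((hz j).of_norm.hasSum.mul_left (t j))
        convert! h2 using 1
        ext i
        rw [Finset.mul_sum]
        exact Finset.sum_congr rfl fun j _ => by ring
      have hc : Continuous fun y : ℝ => Complex.exp (y * Complex.I) := by fun_prop
      exact (hc.tendsto _).comp h1
  refine tendsto_nhds_unique hlim ?_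
  simp_rw [hρ.integral_cexp_partial hα hsum ha hγ, charFun_gammaMeasure ha hγ]
  refine tendsto_finsetProd _ fun j _ => ?_
  have h3 : HasSum (fun i => α (j - i)) a := (Equiv.subLeft j).hasSum_iff.2 hsum
  exact ((continuous_gammaChar γ (t j)).tendsto a).comp h3

end Invariance

/-! ### Iteration of the moment recursion. -/

section Iteration

variable {α : ℤ → ℝ} {a : ℝ} {ρ ν : Measure (ℤ → ℝ)} {r : ℤ → ℝ}
  (hα : ∀ i, 0 ≤ α i) (hsum : HasSum α a) (htwo : ∃ i j, i ≠ j ∧ 0 < α i ∧ 0 < α j)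
include hα hsum htwo

lemma HasMixedMoments.massLaw_iterate (hρ : IsDirichlet α ρ) [IsProbabilityMeasure ν]
    (h : HasMixedMoments ν r) (n : ℕ) :
    HasMixedMoments (massLaw ρ ν n)
      ((pairStep (differenceLaw fun i => α i / a) (1 / (a + 1)))^[n] r) := by
  have := hρ.isProbabilityMeasure
  induction n generalizing ν r with
  | zero => rwa [massLaw_zero]
  | succ n ih =>
    rw [massLaw_succ, Function.iterate_succ_apply]
    exact ih (h.step hα hsum htwo hρ).2

/-- All the series defining the exchange dynamics converge absolutely, almost surely. -/
theorem HasMixedMoments.ae_summable (hρ : IsDirichlet α ρ) [IsProbabilityMeasure ν]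
    (h : HasMixedMoments ν r) :
    ∀ᵐ z ∂ν.prod (environmentLaw ρ), ∀ n j,
      Summable fun i => ‖massAt z.1 z.2 n i * z.2 n i (j - i)‖ := by
  have := hρ.isProbabilityMeasure
  refine ae_all_iff.2 fun n => ?_
  induction n generalizing ν r with
  | zero =>
    have hmp : MeasurePreserving (Prod.map id fun p : ℕ → ℤ → ℤ → ℝ => p 0)
        (ν.prod (environmentLaw ρ)) (ν.prod (rowsLaw ρ)) :=
      (MeasurePreserving.id ν).prod
        (measurePreserving_eval_infinitePi (fun _ : ℕ => rowsLaw ρ) 0)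
    exact hmp.quasiMeasurePreserving.ae (h.step hα hsum htwo hρ).1
  | succ n ih =>
    have hS : Measurable fun z : (ℤ → ℝ) × (ℕ → ℤ → ℤ → ℝ) =>
        (exchangeStep z.1 (z.2 0), fun n => z.2 (n + 1)) := by
      refine Measurable.prodMk ?_ (by fun_prop)
      exact measurable_exchangeStep.comp
        (f := fun z : (ℤ → ℝ) × (ℕ → ℤ → ℤ → ℝ) => (z.1, z.2 0)) (by fun_prop)
    have hmp : MeasurePreserving _ (ν.prod (environmentLaw ρ))
        ((stepLaw ρ ν).prod (environmentLaw ρ)) := ⟨hS, map_step_prodMk_shift⟩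
    have h1 := hmp.quasiMeasurePreserving.ae (ih (h.step hα hsum htwo hρ).2)
    refine h1.mono fun z hz j => ?_
    rw [massAt_succ_eq]
    exact hz j

lemma HasMixedMoments.tendsto_integral_sq (hρ : IsDirichlet α ρ) [IsProbabilityMeasure ν]
    (h : HasMixedMoments ν r) (hr0 : ∀ k, 0 ≤ r k) (hr : Summable r) (j : ℤ) :
    Tendsto (fun n => ∫ x, x j ^ 2 ∂massLaw ρ ν n) atTop (𝓝 0) := by
  have ha := total_pos hα hsum htwo
  have he0 : ∀ i, 0 ≤ α i / a := fun i => div_nonneg (hα i) ha.le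
  have he : HasSum (fun i => α i / a) 1 := by
    simpa only [div_self ha.ne'] using hsum.div_const a
  obtain ⟨i, k, hik, hi, hk⟩ := htwo
  have hpos {l : ℤ} (hl : 0 < α l) : 0 < α l / a := div_pos hl ha
  -- Two distinct positive parameters make the walk both lazy and nontrivial: the difference law
  -- charges `0` and `d = k - i`.
  have h0 := differenceLaw_sub_pos he0 he (hpos hi) (hpos hi)
  rw [sub_self] at h0
  have hκ1 : 1 / (a + 1) < 1 := by
    rw [div_lt_one (by linarith)]
    linarith
  have key := tendsto_pairStep_iterate_zero (differenceLaw_nonneg he0)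
    (hasSum_differenceLaw he0 he) (by positivity) hκ1 h0 (sub_ne_zero.2 hik.symm)
    (differenceLaw_sub_pos he0 he (hpos hi) (hpos hk)) hr0 hr
  refine key.congr fun n => ?_
  have h1 := (h.massLaw_iterate hα hsum ⟨i, k, hik, hi, hk⟩ hρ n).integral_mul j j
  rw [sub_self] at h1
  rw [← h1]
  simp only [sq]

end Iteration

/-! ### Linearity of the dynamics, and tools for the difference of two configurations. -/

lemma massAt_sub {x y : ℤ → ℝ} {p : ℕ → ℤ → ℤ → ℝ}
    (hx : ∀ n j, Summable fun i => massAt x p n i * p n i (j - i))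
    (hy : ∀ n j, Summable fun i => massAt y p n i * p n i (j - i)) (n : ℕ) :
    massAt (x - y) p n = massAt x p n - massAt y p n := by
  induction n with
  | zero => rfl
  | succ n ih =>
    ext j
    simp only [massAt, ih, exchangeStep, Pi.sub_apply, sub_mul]
    exact (hx n j).tsum_sub (hy n j)

/-- For two i.i.d. sequences with equal means the moments at `k ≠ 0` cancel. This gives the
difference process summable initial moments and fixes the rate of the limit. -/
lemma hasMixedMoments_map_sub {ν₁ ν₂ : Measure (ℤ → ℝ)} [IsProbabilityMeasure ν₁]
    [IsProbabilityMeasure ν₂] {r₁ r₂ : ℤ → ℝ} {m₁ m₂ : ℝ} (h₁ : HasMixedMoments ν₁ r₁)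
    (h₂ : HasMixedMoments ν₂ r₂) (hm₁ : ∀ j, ∫ x, x j ∂ν₁ = m₁) (hm₂ : ∀ j, ∫ x, x j ∂ν₂ = m₂) :
    HasMixedMoments ((ν₁.prod ν₂).map fun z => z.1 - z.2)
      fun k => r₁ k + r₂ k - 2 * (m₁ * m₂) := by
  have hmeas : Measurable fun z : (ℤ → ℝ) × (ℤ → ℝ) => z.1 - z.2 :=
    measurable_fst.sub measurable_snd
  have hL₁ (j : ℤ) : MemLp (fun z : (ℤ → ℝ) × (ℤ → ℝ) => z.1 j) 2 (ν₁.prod ν₂) :=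
    (h₁.memLp j).comp_measurePreserving measurePreserving_fst
  have hL₂ (j : ℤ) : MemLp (fun z : (ℤ → ℝ) × (ℤ → ℝ) => z.2 j) 2 (ν₁.prod ν₂) :=
    (h₂.memLp j).comp_measurePreserving measurePreserving_snd
  refine ⟨fun j => ?_, fun j k => ?_⟩
  · rw [memLp_map_measure_iff (measurable_pi_apply j).aestronglyMeasurable hmeas.aemeasurable]
    exact (hL₁ j).sub (hL₂ j)
  · rw [integral_map hmeas.aemeasurable (Measurable.aestronglyMeasurable (by fun_prop))]
    have e (z : (ℤ → ℝ) × (ℤ → ℝ)) : (z.1 - z.2) j * (z.1 - z.2) k =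
        z.1 j * z.1 k + z.2 j * z.2 k - (z.1 j * z.2 k + z.1 k * z.2 j) := by
      simp only [Pi.sub_apply]; ring
    have i₁ : Integrable (fun z : (ℤ → ℝ) × (ℤ → ℝ) => z.1 j * z.1 k) (ν₁.prod ν₂) :=
      (hL₁ j).integrable_mul (hL₁ k)
    have i₂ : Integrable (fun z : (ℤ → ℝ) × (ℤ → ℝ) => z.2 j * z.2 k) (ν₁.prod ν₂) :=
      (hL₂ j).integrable_mul (hL₂ k)
    have i₃ : Integrable (fun z : (ℤ → ℝ) × (ℤ → ℝ) => z.1 j * z.2 k) (ν₁.prod ν₂) :=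
      (hL₁ j).integrable_mul (hL₂ k)
    have i₄ : Integrable (fun z : (ℤ → ℝ) × (ℤ → ℝ) => z.1 k * z.2 j) (ν₁.prod ν₂) :=
      (hL₁ k).integrable_mul (hL₂ j)
    have i₁₂ : Integrable (fun z : (ℤ → ℝ) × (ℤ → ℝ) => z.1 j * z.1 k + z.2 j * z.2 k)
      (ν₁.prod ν₂) := i₁.add i₂
    have i₃₄ : Integrable (fun z : (ℤ → ℝ) × (ℤ → ℝ) => z.1 j * z.2 k + z.1 k * z.2 j)
      (ν₁.prod ν₂) := i₃.add i₄
    simp_rw [e]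
    rw [integral_sub i₁₂ i₃₄, integral_add i₁ i₂, integral_add i₃ i₄,
      integral_prod_mul (fun x : ℤ → ℝ => x j) (fun y : ℤ → ℝ => y k),
      integral_prod_mul (fun x : ℤ → ℝ => x k) (fun y : ℤ → ℝ => y j),
      integral_fun_fst (fun x : ℤ → ℝ => x j * x k),
      integral_fun_snd (fun x : ℤ → ℝ => x j * x k), h₁.integral_mul, h₂.integral_mul,
      hm₁, hm₁, hm₂, hm₂]
    simp
    ring

lemma integral_apply_infinitePi {F : Measure ℝ} [IsProbabilityMeasure F] (j : ℤ) :
    ∫ x, x j ∂(Measure.infinitePi fun _ : ℤ => F) = ∫ x, x ∂F := by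
  have hmp := measurePreserving_eval_infinitePi (fun _ : ℤ => F) j
  conv_rhs => rw [← hmp.map_eq]
  rw [integral_map hmp.measurable.aemeasurable (by fun_prop)]

lemma tendsto_eLpNorm_two_of_tendsto_integral_sq {X : Type*} [MeasurableSpace X] {μ : Measure X}
    {f : ℕ → X → ℝ} (hf : ∀ n, MemLp (f n) 2 μ)
    (h : Tendsto (fun n => ∫ x, f n x ^ 2 ∂μ) atTop (𝓝 0)) :
    Tendsto (fun n => eLpNorm (f n) 2 μ) atTop (𝓝 0) := by
  have h1 : ∀ n, eLpNorm (f n) 2 μ = ENNReal.ofReal (√(∫ x, f n x ^ 2 ∂μ)) := fun n => by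
    rw [(hf n).eLpNorm_eq_integral_rpow_norm (by norm_num) (by norm_num), Real.sqrt_eq_rpow]
    simp
  simp_rw [h1]
  have h2 := (ENNReal.continuous_ofReal.tendsto _).comp h.sqrt
  simpa [Function.comp_def] using h2

lemma tendstoInMeasure_pi_of_tendsto_integral_sq {X ι : Type*} [Fintype ι] [MeasurableSpace X]
    {μ : Measure X} {f : ℕ → X → ι → ℝ} (hf : ∀ n i, MemLp (fun x => f n x i) 2 μ)
    (h : ∀ i, Tendsto (fun n => ∫ x, f n x i ^ 2 ∂μ) atTop (𝓝 0)) :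
    TendstoInMeasure μ f atTop 0 := by
  have hmeas (n : ℕ) : AEStronglyMeasurable (f n) μ :=
    (aemeasurable_pi_iff.2 fun i => (hf n i).1.aemeasurable).aestronglyMeasurable
  refine tendstoInMeasure_of_tendsto_eLpNorm (p := 2) (by norm_num) hmeas
    aestronglyMeasurable_const ?_
  have h1 : Tendsto (fun n => ∑ i, eLpNorm (fun x => ‖f n x i‖) 2 μ) atTop (𝓝 0) := by
    rw [show (0 : ℝ≥0∞) = ∑ _i : ι, 0 by simp]
    refine tendsto_finsetSum _ fun i _ => ?_
    simp_rw [eLpNorm_norm]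
    exact tendsto_eLpNorm_two_of_tendsto_integral_sq (fun n => hf n i) (h i)
  refine tendsto_of_tendsto_of_tendsto_of_le_of_le tendsto_const_nhds h1 (fun _ => zero_le)
    fun n => ?_
  simp only [sub_zero]
  refine le_trans (eLpNorm_mono (g := fun x => ∑ i, ‖f n x i‖) fun x => ?_)
    (eLpNorm_sum_le (f := fun i x => ‖f n x i‖) (fun i _ => (hf n i).1.norm) (by norm_num) |>.trans_eq' ?_)
  · rw [Real.norm_of_nonneg (Finset.sum_nonneg fun i _ => norm_nonneg _)]
    refine (pi_norm_le_iff_of_nonneg (Finset.sum_nonneg fun i _ => norm_nonneg _)).2 fun i => ?_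
    exact Finset.single_le_sum (f := fun i => ‖f n x i‖) (fun i _ => norm_nonneg _)
      (Finset.mem_univ i)
  · congr 1
    ext x
    simp

/-! ### Convergence by coupling with a stationary Gamma configuration. -/

section Convergence

variable {α : ℤ → ℝ} {a : ℝ} {ρ : Measure (ℤ → ℝ)}

/-- From every i.i.d. initial configuration of non-negative masses with finite second moment and
mean `m > 0`, the exchange dynamics converges to independent Gamma variables with mean `m`. -/
theorem IsMassLaw.weaklyConverges (hα : ∀ i, 0 ≤ α i) (hsum : HasSum α a)
    (htwo : ∃ i j, i ≠ j ∧ 0 < α i ∧ 0 < α j) (hρ : IsDirichlet α ρ) {F : Measure ℝ}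
    (hF : IsMassLaw F) :
    WeaklyConverges (massLaw ρ (Measure.infinitePi fun _ : ℤ => F))
      (gammaSequence a (a / ∫ x, x ∂F)) := by
  intro I f
  have ha := total_pos hα hsum htwo
  have := hρ.isProbabilityMeasure
  have := hF.isProbabilityMeasure
  set m := ∫ x, x ∂F with hm
  have hγ : 0 < a / m := div_pos ha hF.mean_pos
  have := isProbabilityMeasure_gammaMeasure ha hγ
  have hgs : IsProbabilityMeasure (gammaSequence a (a / m)) := by
    unfold gammaSequence; infer_instance
  set ν := Measure.infinitePi fun _ : ℤ => F
  set G := gammaSequence a (a / m)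
  have hν : HasMixedMoments ν _ := hasMixedMoments_infinitePi hF.memLp_two
  have hG : HasMixedMoments G _ := hasMixedMoments_infinitePi (memLp_two_gammaMeasure ha hγ)
  have hmG : ∫ x, x ∂gammaMeasure a (a / m) = m := by
    rw [integral_id_gammaMeasure ha hγ, div_div_cancel₀ ha.ne']
  have hdiff := hasMixedMoments_map_sub hν hG (fun j => integral_apply_infinitePi j)
    (fun j => integral_apply_infinitePi j)
  set D := (ν.prod G).map fun z => z.1 - z.2 with hD
  have hsubmeas : Measurable fun z : (ℤ → ℝ) × (ℤ → ℝ) => z.1 - z.2 :=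
    measurable_fst.sub measurable_snd
  have hDprob : IsProbabilityMeasure D := Measure.isProbabilityMeasure_map hsubmeas.aemeasurable
  simp only [hmG, ← hm] at hdiff
  have hr (k : ℤ) (hk : k ≠ 0) : ((if k = 0 then ∫ x, x ^ 2 ∂F else m ^ 2) +
      (if k = 0 then ∫ x, x ^ 2 ∂gammaMeasure a (a / m) else m ^ 2) - 2 * (m * m)) = 0 := by
    rw [if_neg hk, if_neg hk]; ring
  -- At `k = 0` the moment is nonnegative as the integral of a square; elsewhere it vanishes.
  have hsq := hdiff.tendsto_integral_sq hα hsum htwo hρ (fun k => by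
    by_cases hk : k = 0
    · subst hk
      have h0 := hdiff.integral_mul 0 0
      rw [sub_self] at h0
      rw [← h0]
      exact integral_nonneg fun x => mul_self_nonneg _
    · exact (hr k hk).ge) (summable_of_ne_finset_zero (s := {0}) fun k hk =>
      hr k (by simpa using hk))
  -- The coupling: both initial configurations, independent of each other, use one common
  -- environment.
  let P := (ν.prod G).prod (environmentLaw ρ)
  let X (n : ℕ) (w : ((ℤ → ℝ) × (ℤ → ℝ)) × (ℕ → ℤ → ℤ → ℝ)) : I → ℝ :=
    I.restrict (massAt w.1.2 w.2 n)
  let Y (n : ℕ) (w : ((ℤ → ℝ) × (ℤ → ℝ)) × (ℕ → ℤ → ℤ → ℝ)) : I → ℝ :=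
    I.restrict (massAt w.1.1 w.2 n)
  have hmp₁ : MeasurePreserving (fun w : ((ℤ → ℝ) × (ℤ → ℝ)) × (ℕ → ℤ → ℤ → ℝ) =>
      (w.1.1, w.2)) P (ν.prod (environmentLaw ρ)) :=
    measurePreserving_fst.prod (MeasurePreserving.id _)
  have hmp₂ : MeasurePreserving (fun w : ((ℤ → ℝ) × (ℤ → ℝ)) × (ℕ → ℤ → ℤ → ℝ) =>
      (w.1.2, w.2)) P (G.prod (environmentLaw ρ)) :=
    measurePreserving_snd.prod (MeasurePreserving.id _)
  have hmp₃ : MeasurePreserving (fun w : ((ℤ → ℝ) × (ℤ → ℝ)) × (ℕ → ℤ → ℤ → ℝ) =>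
      (w.1.1 - w.1.2, w.2)) P (D.prod (environmentLaw ρ)) :=
    MeasurePreserving.prod ⟨hsubmeas, rfl⟩ (MeasurePreserving.id _)
  have hmass (n : ℕ) (κ : Measure (ℤ → ℝ)) : MeasurePreserving
      (fun z : (ℤ → ℝ) × (ℕ → ℤ → ℤ → ℝ) => massAt z.1 z.2 n) (κ.prod (environmentLaw ρ))
      (massLaw ρ κ n) := ⟨measurable_massAt n, rfl⟩
  have hrestrict : Measurable (I.restrict : (ℤ → ℝ) → I → ℝ) := by fun_prop
  have hXmeas (n : ℕ) : Measurable (X n) :=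
    hrestrict.comp ((measurable_massAt n).comp hmp₂.measurable)
  have hYmeas (n : ℕ) : Measurable (Y n) :=
    hrestrict.comp ((measurable_massAt n).comp hmp₁.measurable)
  have hXlaw (n : ℕ) : P.map (X n) = G.map I.restrict := by
    have h1 := ((hmass n G).comp hmp₂).map_eq.trans
      (massLaw_eq_of_stepLaw_eq (ν := G) (stepLaw_gammaSequence hα hsum htwo hρ hγ) n)
    rw [← h1, Measure.map_map hrestrict ((hmass n G).comp hmp₂).measurable]
    rfl
  have hYlaw (n : ℕ) : P.map (Y n) = (massLaw ρ ν n).map I.restrict := by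
    rw [← ((hmass n ν).comp hmp₁).map_eq,
      Measure.map_map hrestrict ((hmass n ν).comp hmp₁).measurable]
    rfl
  have hsub : ∀ᵐ w ∂P, ∀ n, Y n w - X n w = I.restrict (massAt (w.1.1 - w.1.2) w.2 n) := by
    filter_upwards [hmp₁.quasiMeasurePreserving.ae (hν.ae_summable hα hsum htwo hρ),
      hmp₂.quasiMeasurePreserving.ae (hG.ae_summable hα hsum htwo hρ)] with w h1 h2 n
    rw [massAt_sub (fun n j => (h1 n j).of_norm) (fun n j => (h2 n j).of_norm)]
    rfl
  -- By invariance `X n` has the same law for all `n`, so its convergence is trivial. Slutsky's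
  -- argument then transfers it to `Y`, because `Y - X` tends to zero in measure.
  have hXdist : TendstoInDistribution X atTop (fun x : ℤ → ℝ => I.restrict x) (fun _ => P) G :=
    tendstoInDistribution_of_identDistrib 0
      (fun j => ⟨(hXmeas 0).aemeasurable, (hXmeas j).aemeasurable, by rw [hXlaw, hXlaw]⟩)
      ⟨(hXmeas 0).aemeasurable, hrestrict.aemeasurable, hXlaw 0⟩
  have hzero : TendstoInMeasure P (Y - X) atTop 0 := by
    have hcomp (n : ℕ) := (hmass n D).comp hmp₃
    have hmemLp (n : ℕ) (j : ℤ) :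
        MemLp (fun w : ((ℤ → ℝ) × (ℤ → ℝ)) × (ℕ → ℤ → ℤ → ℝ) =>
          massAt (w.1.1 - w.1.2) w.2 n j) 2 P :=
      ((hdiff.massLaw_iterate hα hsum htwo hρ n).memLp j).comp_measurePreserving (hcomp n)
    have h1 : TendstoInMeasure P (fun n w => I.restrict (massAt (w.1.1 - w.1.2) w.2 n))
        atTop 0 := by
      refine tendstoInMeasure_pi_of_tendsto_integral_sq (fun n j => hmemLp n j) fun j => ?_
      refine (hsq j).congr fun n => ?_
      rw [← (hcomp n).map_eq, integral_map (hcomp n).measurable.aemeasurable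
        (Measurable.aestronglyMeasurable (by fun_prop))]
      rfl
    exact h1.congr_left fun n => hsub.mono fun w hw => (hw n).symm
  have hYdist := tendstoInDistribution_of_tendstoInMeasure_sub Y _ hXdist hzero
    fun n => (hYmeas n).aemeasurable
  have hfin := ProbabilityMeasure.tendsto_iff_forall_integral_tendsto.1 hYdist.tendsto f
  simp only [ProbabilityMeasure.coe_mk] at hfin
  rw [integral_map hrestrict.aemeasurable f.continuous.aestronglyMeasurable] at hfin
  refine hfin.congr fun n => ?_
  rw [hYlaw, integral_map hrestrict.aemeasurable f.continuous.aestronglyMeasurable]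

end Convergence

/-! ### Identification of the fixed points. -/

section FixedPoints

variable {α : ℤ → ℝ} {a γ : ℝ} {ρ : Measure (ℤ → ℝ)}

lemma isProbabilityMeasure_gammaSequence (ha : 0 < a) (hγ : 0 < γ) :
    IsProbabilityMeasure (gammaSequence a γ) := by
  have := isProbabilityMeasure_gammaMeasure ha hγ
  unfold gammaSequence
  infer_instance

lemma gammaSequence_map_const_mul (ha : 0 < a) (hγ : 0 < γ) {c : ℝ} (hc : 0 < c) :
    (gammaSequence a γ).map (fun x i => c * x i) = gammaSequence a (γ / c) := by
  have := isProbabilityMeasure_gammaMeasure ha hγ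
  rw [gammaSequence, Measure.infinitePi_map_pi (μ := fun _ : ℤ => gammaMeasure a γ)
    (f := fun _ x => c * x) fun _ => measurable_const_mul c]
  simp_rw [gammaMeasure_map_const_mul ha hγ hc]
  rfl

lemma eq_of_integral_restrict_eq {ν ν' : Measure (ℤ → ℝ)} [IsProbabilityMeasure ν]
    [IsProbabilityMeasure ν']
    (h : ∀ (I : Finset ℤ) (f : (I → ℝ) →ᵇ ℝ),
      ∫ x, f (I.restrict x) ∂ν = ∫ x, f (I.restrict x) ∂ν') : ν = ν' := by
  refine IsProjectiveLimit.unique (P := fun I : Finset ℤ => ν'.map I.restrict)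
    (fun I => ?_) fun I => rfl
  have hI : Measurable (I.restrict : (ℤ → ℝ) → I → ℝ) := by fun_prop
  have : IsProbabilityMeasure (ν.map I.restrict) :=
    Measure.isProbabilityMeasure_map hI.aemeasurable
  have : IsProbabilityMeasure (ν'.map I.restrict) :=
    Measure.isProbabilityMeasure_map hI.aemeasurable
  refine ext_of_forall_integral_eq_of_IsFiniteMeasure fun f => ?_
  rw [integral_map hI.aemeasurable f.continuous.aestronglyMeasurable,
    integral_map hI.aemeasurable f.continuous.aestronglyMeasurable]
  exact h I f

theorem isFixedPoint_gammaSequence (hα : ∀ i, 0 ≤ α i) (hsum : HasSum α a)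
    (htwo : ∃ i j, i ≠ j ∧ 0 < α i ∧ 0 < α j) (hρ : IsDirichlet α ρ) (hγ : 0 < γ) :
    IsFixedPoint ρ (gammaSequence a γ) := by
  have ha := total_pos hα hsum htwo
  have := hρ.isProbabilityMeasure
  have := isProbabilityMeasure_gammaMeasure ha hγ
  have := isProbabilityMeasure_gammaSequence ha hγ
  refine ⟨this, ?_, ?_, fun F hF => ?_⟩
  · have hG : HasMixedMoments (gammaSequence a γ) _ :=
      hasMixedMoments_infinitePi (memLp_two_gammaMeasure ha hγ)
    exact (hG.ae_summable hα hsum htwo hρ).mono fun z hz j => (hz 0 j).of_norm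
  · rw [massLaw_one, stepLaw_gammaSequence hα hsum htwo hρ hγ]
  · have hm := hF.mean_pos
    -- Scaling by `c` divides the rate by `c`; this `c` makes the new rate `a / ∫ x, x ∂F`.
    refine ⟨γ * (∫ x, x ∂F) / a, by positivity, ?_⟩
    rw [gammaSequence_map_const_mul ha hγ (by positivity)]
    convert! hF.weaklyConverges hα hsum htwo hρ using 2
    field_simp

theorem IsFixedPoint.exists_eq_gammaSequence (hα : ∀ i, 0 ≤ α i) (hsum : HasSum α a)
    (htwo : ∃ i j, i ≠ j ∧ 0 < α i ∧ 0 < α j) (hρ : IsDirichlet α ρ) {ν : Measure (ℤ → ℝ)}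
    (hν : IsFixedPoint ρ ν) : ∃ γ : ℝ, 0 < γ ∧ ν = gammaSequence a γ := by
  have ha := total_pos hα hsum htwo
  have := hν.isProbabilityMeasure
  -- One admissible initial law suffices to determine `ν` up to scaling.
  have hF := isMassLaw_gammaMeasure ha one_pos
  obtain ⟨c, hc, hconv⟩ := hν.attracts _ hF
  have hconv' := hF.weaklyConverges hα hsum htwo hρ
  have hβ : 0 < a / ∫ x, x ∂gammaMeasure a 1 := div_pos ha hF.mean_pos
  set β := a / ∫ x, x ∂gammaMeasure a 1
  have := isProbabilityMeasure_gammaSequence ha hβ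
  have hmul (b : ℝ) : Measurable fun (x : ℤ → ℝ) i => b * x i := by fun_prop
  have : IsProbabilityMeasure (ν.map fun x i => c * x i) :=
    Measure.isProbabilityMeasure_map (hmul c).aemeasurable
  have heq : (ν.map fun x i => c * x i) = gammaSequence a β :=
    eq_of_integral_restrict_eq fun I f => tendsto_nhds_unique (hconv I f) (hconv' I f)
  refine ⟨β / c⁻¹, by positivity, ?_⟩
  rw [← gammaSequence_map_const_mul ha hβ (inv_pos.2 hc), ← heq,
    Measure.map_map (hmul _) (hmul _)]
  have : (fun (x : ℤ → ℝ) i => c⁻¹ * x i) ∘ (fun x i => c * x i) = id := by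
    ext x i
    simp [hc.ne']
  rw [this, Measure.map_id]

end FixedPoints

/-! ### Transfer to a random exchange model on an arbitrary probability space. -/

section Model

variable {Ω : Type*} [MeasurableSpace Ω] {P : Measure Ω} [IsProbabilityMeasure P]
  {F : Measure ℝ} {ρ : Measure (ℤ → ℝ)} {τ : ℤ → Ω → ℝ} {p : ℕ → ℤ → Ω → ℤ → ℝ}

/-- The joint law of the initial configuration and of the environment in an exchange model. -/
lemma IsExchangeModel.measurePreserving (h : IsExchangeModel P F ρ τ p) :
    MeasurePreserving (fun ω => ((fun i => τ i ω), fun n i => p n i ω)) P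
      ((Measure.infinitePi fun _ : ℤ => F).prod (environmentLaw ρ)) := by
  have hρ : IsProbabilityMeasure ρ := by
    rw [← h.law_prop 0 0]
    exact Measure.isProbabilityMeasure_map (h.measurable_prop 0 0).aemeasurable
  have hτ : Measurable fun ω i => τ i ω := measurable_pi_lambda _ h.measurable_mass
  have hp : Measurable fun ω (k : ℕ × ℤ) => p k.1 k.2 ω :=
    measurable_pi_lambda _ fun k => h.measurable_prop k.1 k.2
  have hcurry := (MeasurableEquiv.curry ℕ ℤ (ℤ → ℝ)).measurable
  have hlawτ : P.map (fun ω i => τ i ω) = Measure.infinitePi fun _ : ℤ => F := by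
    rw [(iIndepFun_iff_map_fun_eq_infinitePi_map h.measurable_mass).1 h.indep_mass]
    simp_rw [h.law_mass]
  have hlawp : P.map (fun ω n i => p n i ω) = environmentLaw ρ := by
    have h1 := (iIndepFun_iff_map_fun_eq_infinitePi_map
      fun k : ℕ × ℤ => h.measurable_prop k.1 k.2).1 h.indep_prop
    simp_rw [h.law_prop] at h1
    have h2 := Measure.infinitePi_map_curry (fun (_ : ℕ) (_ : ℤ) => ρ)
    rw [← h1, Measure.map_map hcurry hp] at h2
    exact h2
  have hind : IndepFun (fun ω i => τ i ω) (fun ω n i => p n i ω) P :=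
    h.indep.comp measurable_id hcurry
  have hp' : Measurable fun ω n i => p n i ω := hcurry.comp hp
  refine ⟨hτ.prodMk hp', ?_⟩
  rw [(indepFun_iff_map_prod_eq_prod_map_map hτ.aemeasurable hp'.aemeasurable).1 hind, hlawτ,
    hlawp]

end Model

end RandomExchange

theorem mainTheorem4 (α : ℤ → ℝ) (a : ℝ) (hα : ∀ i, 0 ≤ α i) (hsum : HasSum α a)
    (htwo : ∃ i j, i ≠ j ∧ 0 < α i ∧ 0 < α j)
    (ρ : Measure (ℤ → ℝ)) (hρ : RandomExchange.IsDirichlet α ρ) :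
    (∀ ν : Measure (ℤ → ℝ), RandomExchange.IsFixedPoint ρ ν ↔
      ∃ γ : ℝ, 0 < γ ∧ ν = RandomExchange.gammaSequence a γ) ∧
    (∀ (Ω : Type*) [MeasurableSpace Ω] (P : Measure Ω) [IsProbabilityMeasure P]
      (F : Measure ℝ) (τ : ℤ → Ω → ℝ) (p : ℕ → ℤ → Ω → ℤ → ℝ),
      RandomExchange.IsMassLaw F → RandomExchange.IsExchangeModel P F ρ τ p →
      (∀ᵐ ω ∂P, ∀ n j, Summable fun i =>
        RandomExchange.massAt (fun i => τ i ω) (fun n i => p n i ω) n i * p n i ω (j - i)) ∧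
      RandomExchange.WeaklyConverges
        (fun n => P.map fun ω => RandomExchange.massAt (fun i => τ i ω) (fun n i => p n i ω) n)
        (RandomExchange.gammaSequence a (a / ∫ ω, τ 0 ω ∂P))) := by
  refine ⟨fun ν => ⟨fun hν => hν.exists_eq_gammaSequence hα hsum htwo hρ, ?_⟩, ?_⟩
  · rintro ⟨γ, hγ, rfl⟩
    exact RandomExchange.isFixedPoint_gammaSequence hα hsum htwo hρ hγ
  · intro Ω _ P _ F τ p hF hmodel
    have := hF.isProbabilityMeasure
    have hmp := hmodel.measurePreserving
    have hmean : ∫ ω, τ 0 ω ∂P = ∫ x, x ∂F := by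
      rw [← hmodel.law_mass 0, integral_map (hmodel.measurable_mass 0).aemeasurable (by fun_prop)]
    constructor
    · have h := (RandomExchange.hasMixedMoments_infinitePi hF.memLp_two).ae_summable
        hα hsum htwo hρ
      exact (hmp.quasiMeasurePreserving.ae h).mono fun ω hω n j => (hω n j).of_norm
    · rw [hmean]
      convert! hF.weaklyConverges hα hsum htwo hρ using 2 with n
      rw [RandomExchange.massLaw, ← hmp.map_eq,
        Measure.map_map (RandomExchange.measurable_massAt n) hmp.measurable]
      rfl
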